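/- Let $n\ge 1$, let $J_0(x,y)=(-y,x)$ on $\mathbb R^{2n}=\mathbb R^n\times\mathbb R^n$, let $\omega_0(u,v)=J_0u\cdot v$, and let $\mathrm{Sp}(2n)$ be the group of linear automorphisms of $(\mathbb R^{2n},\omega_0)$. Let $\pi:\widetilde{\mathrm{Sp}}(2n)\to\mathrm{Sp}(2n)$, $[w]\mapsto w(1)$, be the universal cover, realized as the group of homotopy classes with fixed end-points of continuous paths $w:[0,1]\to\mathrm{Sp}(2n)$ with $w(0)=\mathrm{id}$. Let $\mathrm{sp}^+(2n)$ be the open cone of endomorphisms $X$ of $\mathbb R^{2n}$ such that the bilinear form $(u,v)\mapsto\omega_0(u,Xv)$ is symmetric and positive definite. A $C^1$ curve $w:I\to\widetilde{\mathrm{Sp}}(2n)$ on an interval $I\subset\mathbb R$ is called causal if its projection $W=\pi\circ w$ satisfies $W'(t)W(t)^{-1}\in\overline{\mathrm{sp}^+(2n)}\setminus\{0\}$ for every $t\in I$. A function $f:G\to\mathbb R$ on a group $G$ is a quasimorphism if $\sup_{v,w\in G}|f(vw)-f(v)-f(w)|<\infty$, and it is homogeneous if $f(w^k)=kf(w)$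 for all $w\in G$, $k\in\mathbb Z$. Let $\mu:\widetilde{\mathrm{Sp}}(2n)\to\mathbb R$ be the homogeneous Maslov quasimorphism, i.e. the unique homogeneous quasimorphism whose restriction to $\pi^{-1}(\mathrm U(n))$, where $\mathrm U(n)=\mathrm O(2n)\cap\mathrm{Sp}(2n)$, is the lift of the complex determinant: it is continuous on $\pi^{-1}(\mathrm U(n))$, it satisfies $e^{2\pi i\mu(w)}=\det_{\mathbb C}\pi(w)$ there, and $\mu(\mathrm{id})=0$. (Part of the statement is that such a $\mu$ exists and is unique.) Then for every $\epsilon>0$ there is a function $f:\widetilde{\mathrm{Sp}}(2n)\to\mathbb R$ such that: (i) $f$ is a time function on $(\widetilde{\mathrm{Sp}}(2n),\mathrm{sp}^+(2n))$, i.e. $f$ is continuous and $t\mapsto f(w(t))$ is strictly increasing for every causal curve $w$; (ii) $f$ is an unbounded quasimorphism; (iii) $|f(w)-\mu(w)|\le\epsilon$ for all $w\in\widetilde{\mathrm{Sp}}(2n)$. -/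

import Mathlib

open Matrix

namespace SympTime

/-- The linear symplectic group `Sp(2n)`, with the topology induced from the space of matrices. -/
abbrev Sp (n : ℕ) : Type := symplecticGroup (Fin n) ℝ

instance instIsTopologicalGroupSp (n : ℕ) : IsTopologicalGroup (Sp n) where
  continuous_inv := by
    refine Continuous.subtype_mk ?_ _
    exact (continuous_const.matrix_mul continuous_subtype_val.matrix_transpose).matrix_mul
      continuous_const

/-- The group, under pointwise multiplication, of continuous paths `[0,1] → Sp(2n)` starting at
the identity, with the topology of uniform convergence (the compact-open topology). -/
def basedPaths (n : ℕ) : Subgroup C(unitInterval, Sp n) where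
  carrier := {γ | γ 0 = 1}
  one_mem' := by simp
  mul_mem' := by
    intro a b ha hb
    simp only [Set.mem_ofPred_eq] at ha hb
    simp [ha, hb]
  inv_mem' := by
    intro a ha
    simp only [Set.mem_ofPred_eq] at ha
    simp [ha]

/-- Two continuous maps into a topological group that are homotopic relative to `S` may be
multiplied. -/
theorem homotopicRel_mul {n : ℕ} {S : Set unitInterval} {a a' b b' : C(unitInterval, Sp n)}
    (h : a.HomotopicRel a' S) (h' : b.HomotopicRel b' S) : (a * b).HomotopicRel (a' * b') S := by
  obtain ⟨F⟩ := h
  obtain ⟨G⟩ := h'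
  refine ⟨⟨⟨F.toContinuousMap * G.toContinuousMap, ?_, ?_⟩, ?_⟩⟩
  · intro x; simp
  · intro x; simp
  · intro t x hx
    have h1 := F.eq_fst t hx
    have h2 := G.eq_fst t hx
    change F (t, x) * G (t, x) = a x * b x
    rw [h1, h2]

theorem homotopicRel_inv {n : ℕ} {S : Set unitInterval} {a a' : C(unitInterval, Sp n)}
    (h : a.HomotopicRel a' S) : a⁻¹.HomotopicRel a'⁻¹ S := by
  obtain ⟨F⟩ := h
  refine ⟨⟨⟨F.toContinuousMap⁻¹, ?_, ?_⟩, ?_⟩⟩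
  · intro x; simp
  · intro x; simp
  · intro t x hx
    have h1 := F.eq_fst t hx
    change (F (t, x))⁻¹ = (a x)⁻¹
    rw [h1]

/-- The subgroup of loops at the identity that are null-homotopic with fixed end-points. -/
def nullLoops (n : ℕ) : Subgroup (basedPaths n) where
  carrier := {γ | (γ : C(unitInterval, Sp n)).HomotopicRel 1 {0, 1}}
  one_mem' := ContinuousMap.HomotopicRel.refl _
  mul_mem' := by
    intro a b ha hb
    simpa using homotopicRel_mul ha hb
  inv_mem' := by
    intro a ha
    simpa using homotopicRel_inv ha

instance instNormalNullLoops (n : ℕ) : (nullLoops n).Normal where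
  conj_mem := by
    intro a ha g
    have h := homotopicRel_mul
      (homotopicRel_mul (ContinuousMap.HomotopicRel.refl (g : C(unitInterval, Sp n))) ha)
      (ContinuousMap.HomotopicRel.refl (g : C(unitInterval, Sp n))⁻¹)
    simpa [nullLoops] using h

/-- The universal cover of `Sp(2n)`: the set of homotopy classes with fixed end-points of paths in
`Sp(2n)` starting at the identity (see `mk_eq_mk_iff`), with pointwise multiplication and the
quotient topology. -/
abbrev SpCover (n : ℕ) : Type := basedPaths n ⧸ nullLoops n

theorem mk_eq_mk_iff {n : ℕ} (γ γ' : basedPaths n) :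
    (γ : SpCover n) = (γ' : SpCover n) ↔
      (γ : C(unitInterval, Sp n)).HomotopicRel (γ' : C(unitInterval, Sp n)) {0, 1} := by
  rw [QuotientGroup.eq]
  constructor
  · intro h
    have h1 : ((γ⁻¹ * γ' : basedPaths n) : C(unitInterval, Sp n)).HomotopicRel 1 {0, 1} := h
    have h2 := homotopicRel_mul
      (ContinuousMap.HomotopicRel.refl (γ : C(unitInterval, Sp n))) h1
    simpa using h2.symm
  · intro h
    have h2 := homotopicRel_mul
      (ContinuousMap.HomotopicRel.refl (γ : C(unitInterval, Sp n))⁻¹) h.symm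
    change ((γ⁻¹ * γ' : basedPaths n) : C(unitInterval, Sp n)).HomotopicRel 1 {0, 1}
    simpa using h2

/-- The covering homomorphism `[w] ↦ w(1)`. -/
def proj (n : ℕ) : SpCover n →* Sp n :=
  QuotientGroup.lift (nullLoops n)
    { toFun := fun γ => (γ : C(unitInterval, Sp n)) 1
      map_one' := rfl
      map_mul' := fun _ _ => rfl }
    (by
      rintro γ ⟨F⟩
      have h := F.fst_eq_snd (x := (1 : unitInterval)) (by simp)
      exact h)

/-- The standard symplectic form `ω₀(u,v) = J₀ u · v` on `ℝ²ⁿ`, where `J₀(x,y) = (-y,x)`. -/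
def omega {n : ℕ} (u v : Fin n ⊕ Fin n → ℝ) : ℝ := (J (Fin n) ℝ *ᵥ u) ⬝ᵥ v

/-- The open cone `sp⁺(2n)`: those `X` for which the bilinear form `(u,v) ↦ ω₀(u, X v)` is
symmetric and positive definite. -/
def spPlus (n : ℕ) : Set (Matrix (Fin n ⊕ Fin n) (Fin n ⊕ Fin n) ℝ) :=
  {X | (∀ u v, omega u (X *ᵥ v) = omega v (X *ᵥ u)) ∧ ∀ u, u ≠ 0 → 0 < omega u (X *ᵥ u)}

/-- Causal vectors in the Lie algebra: the non-zero elements of the closure of `sp⁺(2n)`. -/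
def causalCone (n : ℕ) : Set (Matrix (Fin n ⊕ Fin n) (Fin n ⊕ Fin n) ℝ) :=
  closure (spPlus n) \ {0}

/-- `w` restricts to a causal `C¹` curve in the universal cover on the interval `s`.
The smooth structure of the universal cover is the one that makes `proj` a local diffeomorphism,
so `w` is `C¹` exactly when it is continuous and `W = proj ∘ w` is `C¹` as a matrix valued curve
(one-sided derivatives at the end-points of `s`). The derivative is causal when
`W'(t) = X(t) W(t)` with `X(t)` in the causal cone, the cone distribution being obtained from
`sp⁺(2n)` by translation. -/
def IsCausalCurveOn {n : ℕ} (w : ℝ → SpCover n) (s : Set ℝ) : Prop :=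
  ContinuousOn w s ∧
  ∃ X : ℝ → Matrix (Fin n ⊕ Fin n) (Fin n ⊕ Fin n) ℝ,
    ContinuousOn X s ∧
    (∀ t ∈ s, X t ∈ causalCone n) ∧
    ∀ t ∈ s, ∀ i j, HasDerivWithinAt
      (fun τ => (proj n (w τ) : Matrix (Fin n ⊕ Fin n) (Fin n ⊕ Fin n) ℝ) i j)
      ((X t * (proj n (w t) : Matrix (Fin n ⊕ Fin n) (Fin n ⊕ Fin n) ℝ)) i j) s t

/-- A time function: a continuous function, strictly increasing along every causal curve.
The curve may be defined on any interval `s` of the real line. -/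
def IsTimeFunction {n : ℕ} (f : SpCover n → ℝ) : Prop :=
  Continuous f ∧
  ∀ (s : Set ℝ) (w : ℝ → SpCover n), s.OrdConnected → IsCausalCurveOn w s →
    StrictMonoOn (fun t => f (w t)) s

/-- Real quasimorphisms on a group. -/
def IsQuasimorphism {G : Type*} [Group G] (f : G → ℝ) : Prop :=
  ∃ C : ℝ, ∀ v w : G, |f (v * w) - f v - f w| ≤ C

/-- Homogeneous real functions on a group. -/
def IsHomogeneous {G : Type*} [Group G] (f : G → ℝ) : Prop :=
  ∀ (w : G) (k : ℤ), f (w ^ k) = k * f w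

/-- The subgroup `U(n) = O(2n) ∩ Sp(2n)`, as a set. -/
def unitarySet (n : ℕ) : Set (Sp n) :=
  {W | (W : Matrix (Fin n ⊕ Fin n) (Fin n ⊕ Fin n) ℝ) ∈ orthogonalGroup (Fin n ⊕ Fin n) ℝ}

/-- The complex determinant on `U(n)`. Under `ℝ²ⁿ ≅ ℂⁿ`, `(x,y) ↦ x + iy` (so that `J₀` is
multiplication by `i`), an element of `U(n)` has the block form `(a, -c; c, a)` and corresponds to
the complex matrix `a + ic`. -/
noncomputable def complexDet {n : ℕ} (W : Sp n) : ℂ :=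
  ((W : Matrix (Fin n ⊕ Fin n) (Fin n ⊕ Fin n) ℝ).toBlocks₁₁.map Complex.ofReal +
    Complex.I •
      (W : Matrix (Fin n ⊕ Fin n) (Fin n ⊕ Fin n) ℝ).toBlocks₂₁.map Complex.ofReal).det

/-- The defining properties of the homogeneous Maslov quasimorphism: it is a homogeneous
quasimorphism, and on the inverse image of `U(n)` it is the lift of the complex determinant, i.e.
it is continuous there, `exp (2πi μ(w)) = det_ℂ (proj w)`, and `μ(1) = 0` (which is part of
homogeneity). -/
def IsMaslov {n : ℕ} (μ : SpCover n → ℝ) : Prop :=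
  IsQuasimorphism μ ∧ IsHomogeneous μ ∧
  ContinuousOn μ (proj n ⁻¹' unitarySet n) ∧
  ∀ w : SpCover n, proj n w ∈ unitarySet n →
    Complex.exp (2 * Real.pi * Complex.I * (μ w : ℂ)) = complexDet (proj n w)

end SympTime

/-! Over ℂ, split `ℂ²ⁿ` into the `±i`-eigenspaces of `J₀`. A symplectic `W` preserves the Hermitian
form `|y₊|² - |y₋|²`, so its complex linear part `P` and antilinear part `Q` satisfy `|Py|² - |Qy|²
= |y|²`. Hence `P` is invertible, `det P` maps into `ℂ \ {0}`, and its argument lifts to a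
continuous function `angle` on the universal cover, measured in turns.

`angle` is a quasimorphism: `P(VW) = P(V)(1 + C)P(W)` with `1 + sC` invertible for all `s ∈ [0,1]`,
so for each eigenvalue `z` of `C` the number `1 + z` avoids `(-∞,0]`, and the argument of `det(1 +
C)` is at most `nπ` (`exists_starInvertible_log`, `exists_coverLog_mul`). It is a time function,
because `tr(P⁻¹P')` has positive imaginary part in causal directions (`im_trace_pos`): `QP⁻¹` is a
strict contraction.

Homogenizing `angle` gives `μ`, at distance at most `n/2` from it. Products of causal curves are
causal, the cone being convex, pointed and conjugation invariant. Therefore `angle (w ^ (k+1)) /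
(k+1)` is still a time function, and its distance to `μ` is at most `n / (2(k+1))`.

For uniqueness, the difference of two candidates is a homogeneous quasimorphism, hence conjugation
invariant. It vanishes on unitary paths, and on positive symmetric paths `p` because `J₀ p J₀⁻¹ =
p⁻¹`. By polar decomposition it is bounded, hence zero. -/

namespace SympTime

/-! ### Homogeneous quasimorphisms and homogenization. -/

section Quasimorphism

variable {G : Type*} [Group G] {f g : G → ℝ}

theorem eq_zero_of_forall_nat_mul_le {a C : ℝ} (h : ∀ k : ℕ, k * |a| ≤ C) : a = 0 := by
  by_contra ha
  obtain ⟨k, hk⟩ := exists_nat_gt (C / |a|)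
  have := (div_lt_iff₀ (abs_pos.2 ha)).1 hk
  linarith [h k]

theorem IsHomogeneous.map_pow (hf : IsHomogeneous f) (w : G) (k : ℕ) : f (w ^ k) = k * f w := by
  simpa using hf w k

theorem IsHomogeneous.map_inv (hf : IsHomogeneous f) (w : G) : f w⁻¹ = -f w := by
  simpa using hf w (-1)

theorem IsHomogeneous.sub (hf : IsHomogeneous f) (hg : IsHomogeneous g) :
    IsHomogeneous (fun w => f w - g w) := fun w k => by
  simp only [hf w k, hg w k]; ring

theorem IsQuasimorphism.of_abs_sub_le (hf : IsQuasimorphism f) {C : ℝ}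
    (h : ∀ w, |f w - g w| ≤ C) : IsQuasimorphism g := by
  obtain ⟨D, hD⟩ := hf
  refine ⟨D + 3 * C, fun v w => ?_⟩
  have h1 := abs_le.1 (h (v * w))
  have h2 := abs_le.1 (h v)
  have h3 := abs_le.1 (h w)
  have h4 := abs_le.1 (hD v w)
  rw [abs_le]
  constructor <;> linarith [h1.1, h1.2, h2.1, h2.2, h3.1, h3.2, h4.1, h4.2]

theorem IsQuasimorphism.sub (hf : IsQuasimorphism f) (hg : IsQuasimorphism g) :
    IsQuasimorphism (fun w => f w - g w) := by
  obtain ⟨D, hD⟩ := hf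
  obtain ⟨D', hD'⟩ := hg
  refine ⟨D + D', fun v w => ?_⟩
  have h1 := abs_le.1 (hD v w)
  have h2 := abs_le.1 (hD' v w)
  rw [abs_le]
  constructor <;> linarith [h1.1, h1.2, h2.1, h2.2]

/-- A bounded homogeneous function vanishes. -/
theorem IsHomogeneous.eq_zero_of_abs_le (hf : IsHomogeneous f) {C : ℝ} (h : ∀ w, |f w| ≤ C)
    (w : G) : f w = 0 := by
  refine eq_zero_of_forall_nat_mul_le (C := C) fun k => ?_
  have := h (w ^ k)
  rwa [hf.map_pow, abs_mul, Nat.abs_cast] at this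

/-- Since `f a⁻¹ = -f a`, the values at `a wᵏ a⁻¹` and `wᵏ` differ by at most twice the defect,
while by homogeneity they differ by `k` times the difference in question. -/
theorem IsQuasimorphism.map_conj (hq : IsQuasimorphism f) (hf : IsHomogeneous f) (a w : G) :
    f (a * w * a⁻¹) = f w := by
  obtain ⟨D, hD⟩ := hq
  rw [← sub_eq_zero]
  refine eq_zero_of_forall_nat_mul_le (C := 2 * D) fun k => ?_
  have h1 := abs_le.1 (hD (a * w ^ k) a⁻¹)
  have h2 := abs_le.1 (hD a (w ^ k))
  rw [← conj_pow, hf.map_pow, hf.map_inv] at h1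
  rw [hf.map_pow] at h2
  rw [← Nat.abs_cast k, ← abs_mul, abs_le]
  constructor <;> linarith [h1.1, h1.2, h2.1, h2.2]

theorem abs_map_pow_succ_sub_le {C : ℝ} (h : ∀ v w, |f (v * w) - f v - f w| ≤ C) (w : G) (k : ℕ) :
    |f (w ^ (k + 1)) - (k + 1) * f w| ≤ k * C := by
  induction k with
  | zero => simp
  | succ k ih =>
    have h1 := abs_le.1 (h (w ^ (k + 1)) w)
    rw [← pow_succ] at h1
    rw [abs_le] at ih ⊢
    push_cast
    constructor <;> linarith [h1.1, h1.2, ih.1, ih.2]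

/-- Every quasimorphism is at bounded distance from a homogeneous function, the bound being its
defect. -/
theorem exists_homogenization {C : ℝ} (h : ∀ v w, |f (v * w) - f v - f w| ≤ C) :
    ∃ μ : G → ℝ, IsHomogeneous μ ∧ ∀ w, |f w - μ w| ≤ C := by
  have hC : 0 ≤ C := (abs_nonneg _).trans (h 1 1)
  have hlim : ∀ w, ∃ l : ℝ, Filter.Tendsto (fun k : ℕ => f (w ^ k) / k) Filter.atTop (nhds l) := by
    intro w
    -- Adding the defect makes the sequence subadditive, so Fekete's lemma gives the limit.
    have hsub : Subadditive (fun k : ℕ => f (w ^ k) + C) := by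
      intro m k
      have := (abs_le.1 (h (w ^ m) (w ^ k))).2
      simp only [pow_add]
      linarith
    have hbdd : BddBelow (Set.range fun k : ℕ => (f (w ^ k) + C) / k) := by
      refine ⟨-(|f w| + C), ?_⟩
      rintro _ ⟨k, rfl⟩
      rcases k with _ | k
      · simp; linarith [abs_nonneg (f w)]
      · have h1 := (abs_le.1 (abs_map_pow_succ_sub_le h w k)).1
        have h2 := neg_abs_le (f w)
        simp only
        rw [le_div_iff₀ (by positivity)]
        push_cast
        nlinarith [mul_nonneg (Nat.cast_nonneg (α := ℝ) k) (sub_nonneg.2 h2)]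
    refine ⟨hsub.lim, ?_⟩
    have h1 := hsub.tendsto_lim hbdd
    have h2 : Filter.Tendsto (fun k : ℕ => C / (k : ℝ)) Filter.atTop (nhds 0) :=
      tendsto_const_div_atTop_nhds_zero_nat C
    have h3 := h1.sub h2
    rw [sub_zero] at h3
    refine h3.congr fun k => ?_
    ring
  choose μ hμ using hlim
  have hpow : ∀ w (j : ℕ), μ (w ^ j) = j * μ w := by
    intro w j
    rcases Nat.eq_zero_or_pos j with rfl | hj
    · have h1 := hμ 1
      have h2 : Filter.Tendsto (fun k : ℕ => f ((1 : G) ^ k) / k) Filter.atTop (nhds 0) := by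
        simpa using tendsto_const_div_atTop_nhds_zero_nat (f 1)
      simpa using tendsto_nhds_unique h1 h2
    · have h1 := hμ (w ^ j)
      have h2 := ((hμ w).comp (Filter.tendsto_id.const_mul_atTop' hj)).const_mul (j : ℝ)
      refine tendsto_nhds_unique h1 (h2.congr fun k => ?_)
      have : (j : ℝ) ≠ 0 := by positivity
      simp only [Function.comp, id, pow_mul]
      push_cast
      rw [mul_div_assoc', mul_div_mul_left _ _ this]
  have hinv : ∀ w, μ w⁻¹ = -μ w := by
    intro w
    have h1 := (hμ w).add (hμ w⁻¹)
    have h2 : Filter.Tendsto (fun k : ℕ => f (w ^ k) / k + f (w⁻¹ ^ k) / k) Filter.atTop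
        (nhds 0) := by
      refine squeeze_zero_norm (a := fun k : ℕ => (C + |f 1|) / k) (fun k => ?_)
        (tendsto_const_div_atTop_nhds_zero_nat _)
      rw [← add_div, Real.norm_eq_abs, abs_div, Nat.abs_cast]
      gcongr
      have h3 := abs_le.1 (h (w ^ k) (w⁻¹ ^ k))
      rw [inv_pow, mul_inv_cancel] at h3
      rw [inv_pow, abs_le]
      constructor <;> linarith [h3.1, h3.2, le_abs_self (f 1), neg_abs_le (f 1)]
    have := tendsto_nhds_unique h1 h2
    linarith
  refine ⟨μ, ?_, ?_⟩
  · intro w k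
    obtain ⟨j, rfl | rfl⟩ := k.eq_nat_or_neg
    · simpa using hpow w j
    · simp [hinv, hpow]
  · intro w
    have h1 : Filter.Tendsto (fun k : ℕ => |f w - f (w ^ k) / k|) Filter.atTop
        (nhds |f w - μ w|) := ((hμ w).const_sub _).abs
    refine le_of_tendsto h1 (Filter.eventually_atTop.2 ⟨1, fun k hk => ?_⟩)
    obtain ⟨k, rfl⟩ := Nat.exists_eq_add_of_le' hk
    have h2 := abs_map_pow_succ_sub_le h w k
    have hk' : (0 : ℝ) < k + 1 := by positivity
    push_cast
    rw [show f w - f (w ^ (k + 1)) / (k + 1) = -((f (w ^ (k + 1)) - (k + 1) * f w) / (k + 1)) by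
      field_simp; ring, abs_neg, abs_div, abs_of_pos hk', div_le_iff₀ hk']
    nlinarith

end Quasimorphism

/-! ### Complex linear and antilinear parts of a symplectic matrix. -/

section ComplexParts

variable {n : ℕ}

/-- The columns span the `i`-eigenspace of `J₀` in `ℂ²ⁿ`. -/
noncomputable def frame (n : ℕ) : Matrix (Fin n ⊕ Fin n) (Fin n) ℂ := fromRows 1 (-Complex.I • 1)

/-- The columns span the `-i`-eigenspace of `J₀` in `ℂ²ⁿ`. -/
noncomputable def coframe (n : ℕ) : Matrix (Fin n ⊕ Fin n) (Fin n) ℂ := fromRows 1 (Complex.I • 1)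

/-- The complexification of a real matrix. -/
noncomputable abbrev cx (W : Matrix (Fin n ⊕ Fin n) (Fin n ⊕ Fin n) ℝ) :
    Matrix (Fin n ⊕ Fin n) (Fin n ⊕ Fin n) ℂ := W.map Complex.ofRealHom

theorem frame_conjTranspose : (frame n)ᴴ = fromCols 1 (Complex.I • 1) := by
  simp [frame, conjTranspose_fromRows_eq_fromCols_conjTranspose]

theorem coframe_conjTranspose : (coframe n)ᴴ = fromCols 1 (-Complex.I • 1) := by
  simp [coframe, conjTranspose_fromRows_eq_fromCols_conjTranspose]

theorem frameH_mul_frame : (frame n)ᴴ * frame n = (2 : ℂ) • 1 := by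
  rw [frame_conjTranspose, frame, fromCols_mul_fromRows]
  simp [smul_smul, two_smul]

theorem coframeH_mul_coframe : (coframe n)ᴴ * coframe n = (2 : ℂ) • 1 := by
  rw [coframe_conjTranspose, coframe, fromCols_mul_fromRows]
  simp [smul_smul, two_smul]

theorem frameH_mul_coframe : (frame n)ᴴ * coframe n = 0 := by
  rw [frame_conjTranspose, coframe, fromCols_mul_fromRows]
  simp [smul_smul]

theorem coframeH_mul_frame : (coframe n)ᴴ * frame n = 0 := by
  rw [coframe_conjTranspose, frame, fromCols_mul_fromRows]
  simp [smul_smul]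

theorem frame_mul_add_coframe_mul :
    frame n * (frame n)ᴴ + coframe n * (coframe n)ᴴ = (2 : ℂ) • 1 := by
  rw [coframe_conjTranspose, coframe, frame_conjTranspose, frame, fromRows_mul_fromCols,
    fromRows_mul_fromCols, fromBlocks_add, ← fromBlocks_one, fromBlocks_smul]
  simp [smul_smul, two_smul]

theorem frame_mul_sub_coframe_mul :
    frame n * (frame n)ᴴ - coframe n * (coframe n)ᴴ = (-2 * Complex.I) • J (Fin n) ℂ := by
  rw [coframe_conjTranspose, coframe, frame_conjTranspose, frame, fromRows_mul_fromCols,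
    fromRows_mul_fromCols, sub_eq_add_neg, fromBlocks_neg, fromBlocks_add, J, fromBlocks_smul]
  congr 1 <;> simp [smul_smul, two_mul, add_smul]

theorem frameH_mul_J : (frame n)ᴴ * J (Fin n) ℂ = Complex.I • (frame n)ᴴ := by
  rw [frame_conjTranspose, J, fromCols_mul_fromBlocks]
  ext i (j | j) <;> simp [← mul_assoc]

theorem coframeH_mul_J : (coframe n)ᴴ * J (Fin n) ℂ = -Complex.I • (coframe n)ᴴ := by
  rw [coframe_conjTranspose, J, fromCols_mul_fromBlocks]
  ext i (j | j) <;> simp [← mul_assoc]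

theorem J_mul_frame : J (Fin n) ℂ * frame n = Complex.I • frame n := by
  rw [frame, J, fromBlocks_mul_fromRows]
  ext (i | i) j <;> simp [← mul_assoc]

/-- The complex linear part of a real matrix. -/
noncomputable def holPart (W : Matrix (Fin n ⊕ Fin n) (Fin n ⊕ Fin n) ℝ) :
    Matrix (Fin n) (Fin n) ℂ := (1 / 2 : ℂ) • ((frame n)ᴴ * cx W * frame n)

/-- The antilinear part of a real matrix, as a map to the `-i`-eigenspace of `J₀`. -/
noncomputable def antiPart (W : Matrix (Fin n ⊕ Fin n) (Fin n ⊕ Fin n) ℝ) :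
    Matrix (Fin n) (Fin n) ℂ := (1 / 2 : ℂ) • ((coframe n)ᴴ * cx W * frame n)

/-- The antilinear part of a real matrix, as a map from the `-i`-eigenspace of `J₀`. -/
noncomputable def coantiPart (W : Matrix (Fin n ⊕ Fin n) (Fin n ⊕ Fin n) ℝ) :
    Matrix (Fin n) (Fin n) ℂ := (1 / 2 : ℂ) • ((frame n)ᴴ * cx W * coframe n)

theorem cx_mul_frame (W : Matrix (Fin n ⊕ Fin n) (Fin n ⊕ Fin n) ℝ) :
    cx W * frame n = frame n * holPart W + coframe n * antiPart W := by
  have h : cx W * frame n = (1 / 2 : ℂ) • (((2 : ℂ) •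
      (1 : Matrix (Fin n ⊕ Fin n) (Fin n ⊕ Fin n) ℂ)) * (cx W * frame n)) := by
    simp
  rw [h, ← frame_mul_add_coframe_mul, Matrix.add_mul, smul_add, holPart, antiPart]
  simp only [Matrix.mul_smul, Matrix.mul_assoc]

/-- The cross term is what keeps `det ∘ holPart` from being multiplicative. -/
theorem holPart_mul (V W : Matrix (Fin n ⊕ Fin n) (Fin n ⊕ Fin n) ℝ) :
    holPart (V * W) = holPart V * holPart W + coantiPart V * antiPart W := by
  rw [holPart, cx, Matrix.map_mul, Matrix.mul_assoc, Matrix.mul_assoc, cx_mul_frame,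
    Matrix.mul_add, Matrix.mul_add, smul_add, holPart.eq_1 V, coantiPart]
  simp only [Matrix.smul_mul, Matrix.mul_assoc]

@[simp]
theorem holPart_one : holPart (1 : Matrix (Fin n ⊕ Fin n) (Fin n ⊕ Fin n) ℝ) = 1 := by
  rw [holPart, cx, Matrix.map_one _ (map_zero _) (map_one _), Matrix.mul_one, frameH_mul_frame,
    smul_smul]
  norm_num

@[simp]
theorem antiPart_one : antiPart (1 : Matrix (Fin n ⊕ Fin n) (Fin n ⊕ Fin n) ℝ) = 0 := by
  rw [antiPart, cx, Matrix.map_one _ (map_zero _) (map_one _), Matrix.mul_one, coframeH_mul_frame,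
    smul_zero]

/-- The squared norm of a complex vector. -/
noncomputable def sqNorm {ι : Type*} [Fintype ι] (v : ι → ℂ) : ℝ := ∑ i, Complex.normSq (v i)

theorem sqNorm_nonneg {ι : Type*} [Fintype ι] (v : ι → ℂ) : 0 ≤ sqNorm v :=
  Finset.sum_nonneg fun _ _ => Complex.normSq_nonneg _

theorem sqNorm_eq_zero {ι : Type*} [Fintype ι] {v : ι → ℂ} : sqNorm v = 0 ↔ v = 0 := by
  rw [sqNorm, Finset.sum_eq_zero_iff_of_nonneg fun _ _ => Complex.normSq_nonneg _]
  simp [funext_iff]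

theorem sqNorm_smul {ι : Type*} [Fintype ι] (c : ℂ) (v : ι → ℂ) :
    sqNorm (c • v) = Complex.normSq c * sqNorm v := by
  simp [sqNorm, Finset.mul_sum]

theorem sqNorm_eq {ι : Type*} [Fintype ι] (v : ι → ℂ) : (sqNorm v : ℂ) = star v ⬝ᵥ v := by
  simp [sqNorm, dotProduct, Complex.normSq_eq_conj_mul_self]

/-- The pairing is bilinear, without conjugation; termwise this is `|v + conj w|² ≥ 0`. -/
theorem neg_le_re_dotProduct {ι : Type*} [Fintype ι] (v w : ι → ℂ) :
    -(sqNorm v + sqNorm w) / 2 ≤ (v ⬝ᵥ w).re := by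
  rw [sqNorm, sqNorm, dotProduct, Complex.re_sum, ← Finset.sum_add_distrib,
    ← Finset.sum_neg_distrib, Finset.sum_div]
  refine Finset.sum_le_sum fun i _ => ?_
  simp only [Complex.normSq_apply, Complex.mul_re]
  nlinarith [sq_nonneg ((v i).re + (w i).re), sq_nonneg ((v i).im - (w i).im)]

theorem sqNorm_frameH_sub (y : Fin n ⊕ Fin n → ℂ) :
    ((sqNorm ((frame n)ᴴ *ᵥ y) - sqNorm ((coframe n)ᴴ *ᵥ y) : ℝ) : ℂ) =
      (-2 * Complex.I) * (star y ⬝ᵥ (J (Fin n) ℂ *ᵥ y)) := by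
  have h : ∀ A : Matrix (Fin n ⊕ Fin n) (Fin n) ℂ,
      (sqNorm (Aᴴ *ᵥ y) : ℂ) = star y ⬝ᵥ ((A * Aᴴ) *ᵥ y) := by
    intro A
    rw [sqNorm_eq, star_mulVec, conjTranspose_conjTranspose, ← dotProduct_mulVec, mulVec_mulVec]
  rw [Complex.ofReal_sub, h, h, ← dotProduct_sub, ← sub_mulVec, frame_mul_sub_coframe_mul,
    smul_mulVec, dotProduct_smul, smul_eq_mul]

theorem cx_conjTranspose_mul_J_mul (W : Sp n) :
    (cx W.1)ᴴ * J (Fin n) ℂ * cx W.1 = J (Fin n) ℂ := by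
  have h1 : (cx W.1)ᴴ = (W.1ᵀ).map Complex.ofRealHom := by
    ext i j; simp [cx]
  have h2 := SymplecticGroup.mem_iff'.1 W.2
  rw [h1, ← Matrix.map_J (Fin n) Complex.ofRealHom, cx, ← Matrix.map_mul, ← Matrix.map_mul, h2]

/-- A symplectic matrix preserves a Hermitian form of signature `(n, n)`. -/
theorem sqNorm_frameH_sub_invariant (W : Sp n) (y : Fin n ⊕ Fin n → ℂ) :
    sqNorm ((frame n)ᴴ *ᵥ (cx W.1 *ᵥ y)) - sqNorm ((coframe n)ᴴ *ᵥ (cx W.1 *ᵥ y)) =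
      sqNorm ((frame n)ᴴ *ᵥ y) - sqNorm ((coframe n)ᴴ *ᵥ y) := by
  have h : (star (cx W.1 *ᵥ y) ⬝ᵥ (J (Fin n) ℂ *ᵥ (cx W.1 *ᵥ y))) =
      star y ⬝ᵥ (J (Fin n) ℂ *ᵥ y) := by
    rw [star_mulVec, ← dotProduct_mulVec, mulVec_mulVec, mulVec_mulVec,
      cx_conjTranspose_mul_J_mul]
  exact_mod_cast (sqNorm_frameH_sub _).trans ((congrArg _ h).trans (sqNorm_frameH_sub y).symm)

/-- The invariant Hermitian form is evaluated on the `i`-eigenspace, where its negative component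
vanishes. -/
theorem sqNorm_holPart_sub (W : Sp n) (y : Fin n → ℂ) :
    sqNorm (holPart W.1 *ᵥ y) - sqNorm (antiPart W.1 *ᵥ y) = sqNorm y := by
  have h := sqNorm_frameH_sub_invariant W (frame n *ᵥ y)
  simp only [mulVec_mulVec, frameH_mul_frame, coframeH_mul_frame, smul_mulVec, sqNorm_smul,
    one_mulVec, zero_mulVec] at h
  rw [holPart, antiPart, smul_mulVec, smul_mulVec, sqNorm_smul, sqNorm_smul, Matrix.mul_assoc,
    Matrix.mul_assoc, ← mul_sub, h]
  simp [sqNorm]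
  ring

/-- With `a = P(W)y` and `b = Q(W)y`, the hypothesis says that `V` sends the vector with components
`a` and `sb` into the `-i`-eigenspace, where the form is nonpositive. So `|a|² ≤ s²|b|² ≤ |b|²`,
against `|a|² - |b|² = |y|²`. -/
theorem eq_zero_of_holPart_mulVec_add (V W : Sp n) {s : ℝ} (hs : s ∈ Set.Icc (0 : ℝ) 1)
    {y : Fin n → ℂ}
    (h : (holPart V.1 * holPart W.1 + (s : ℂ) • (coantiPart V.1 * antiPart W.1)) *ᵥ y = 0) :
    y = 0 := by
  have h1 := sqNorm_holPart_sub W y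
  obtain ⟨a, ha⟩ : ∃ a, a = holPart W.1 *ᵥ y := ⟨_, rfl⟩
  obtain ⟨b, hb⟩ : ∃ b, b = antiPart W.1 *ᵥ y := ⟨_, rfl⟩
  rw [← ha, ← hb] at h1
  have h2 := sqNorm_frameH_sub_invariant V (frame n *ᵥ a + coframe n *ᵥ ((s : ℂ) • b))
  have h3 : (frame n)ᴴ *ᵥ (cx V.1 *ᵥ (frame n *ᵥ a + coframe n *ᵥ ((s : ℂ) • b))) = 0 := by
    have : (2 : ℂ) • ((holPart V.1 * holPart W.1 + (s : ℂ) • (coantiPart V.1 * antiPart W.1)) *ᵥ y)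
      = (frame n)ᴴ *ᵥ (cx V.1 *ᵥ (frame n *ᵥ a + coframe n *ᵥ ((s : ℂ) • b))) := by
      rw [ha, hb, holPart, coantiPart]
      simp only [mulVec_add, add_mulVec, mulVec_mulVec, smul_mulVec, mulVec_smul, smul_add,
        smul_smul, Matrix.smul_mul, Matrix.mul_assoc]
      congr 2
      · norm_num
      · ring
    rw [← this, h, smul_zero]
  have h4 : (frame n)ᴴ *ᵥ (frame n *ᵥ a + coframe n *ᵥ ((s : ℂ) • b)) = (2 : ℂ) • a := by
    rw [mulVec_add, mulVec_mulVec, mulVec_mulVec, frameH_mul_frame, frameH_mul_coframe,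
      smul_mulVec, one_mulVec, zero_mulVec, add_zero]
  have h5 : (coframe n)ᴴ *ᵥ (frame n *ᵥ a + coframe n *ᵥ ((s : ℂ) • b)) =
      (2 : ℂ) • (s : ℂ) • b := by
    rw [mulVec_add, mulVec_mulVec, mulVec_mulVec, coframeH_mul_frame, coframeH_mul_coframe,
      smul_mulVec, one_mulVec, zero_mulVec, zero_add]
  rw [h3, h4, h5, sqNorm_smul, sqNorm_smul, sqNorm_smul, sqNorm_eq_zero.2 rfl] at h2
  simp only [Complex.normSq_ofReal, show Complex.normSq 2 = 4 by norm_num [Complex.normSq_apply]]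
    at h2
  refine sqNorm_eq_zero.1 (le_antisymm ?_ (sqNorm_nonneg y))
  have hs2 : s * s ≤ 1 := by nlinarith [hs.1, hs.2]
  nlinarith [sqNorm_nonneg b, sqNorm_nonneg
    ((coframe n)ᴴ *ᵥ (cx V.1 *ᵥ (frame n *ᵥ a + coframe n *ᵥ ((s : ℂ) • b))))]

theorem det_holPart_mul_add_ne_zero (V W : Sp n) {s : ℝ} (hs : s ∈ Set.Icc (0 : ℝ) 1) :
    (holPart V.1 * holPart W.1 + (s : ℂ) • (coantiPart V.1 * antiPart W.1)).det ≠ 0 := by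
  intro h
  obtain ⟨y, hy, h0⟩ := exists_mulVec_eq_zero_iff.2 h
  exact hy (eq_zero_of_holPart_mulVec_add V W hs h0)

theorem det_holPart_ne_zero (W : Sp n) : (holPart W.1).det ≠ 0 := by
  intro h
  obtain ⟨y, hy, h0⟩ := exists_mulVec_eq_zero_iff.2 h
  refine hy (eq_zero_of_holPart_mulVec_add 1 W (s := 0) (by simp) (y := y) ?_)
  simp [h0]

theorem J_mul_eq_mul_J_of_mem_unitarySet {W : Sp n} (hW : W ∈ unitarySet n) :
    J (Fin n) ℝ * W.1 = W.1 * J (Fin n) ℝ := by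
  have h1 : W.1 * star W.1 = 1 := (mem_orthogonalGroup_iff _ _).1 hW
  have h2 := SymplecticGroup.mem_iff'.1 W.2
  have h3 : W.1 * (W.1ᵀ * J (Fin n) ℝ * W.1) = J (Fin n) ℝ * W.1 := by
    rw [← Matrix.mul_assoc, ← Matrix.mul_assoc]
    change (W.1 * star W.1) * _ * _ = _
    rw [h1, Matrix.one_mul]
  rw [← h3, h2]

theorem antiPart_eq_zero {W : Sp n} (hW : W ∈ unitarySet n) : antiPart W.1 = 0 := by
  have h := congrArg (fun M => (coframe n)ᴴ * M.map Complex.ofRealHom * frame n)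
    (J_mul_eq_mul_J_of_mem_unitarySet hW)
  simp only [Matrix.map_mul, Matrix.map_J] at h
  rw [← Matrix.mul_assoc, coframeH_mul_J, ← Matrix.mul_assoc, Matrix.mul_assoc _ (J _ _),
    J_mul_frame, Matrix.smul_mul, Matrix.smul_mul, Matrix.mul_smul] at h
  have h2 : (2 * Complex.I) • ((coframe n)ᴴ * cx W.1 * frame n) = 0 := by
    rw [two_mul, add_smul]
    nth_rw 1 [← h]
    simp
  rw [antiPart, (smul_eq_zero.1 h2).resolve_left (by simp), smul_zero]

theorem det_holPart_eq_complexDet {W : Sp n} (hW : W ∈ unitarySet n) :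
    (holPart W.1).det = complexDet W := by
  have h := J_mul_eq_mul_J_of_mem_unitarySet hW
  have hP : holPart W.1 = W.1.toBlocks₁₁.map Complex.ofReal +
      Complex.I • W.1.toBlocks₂₁.map Complex.ofReal := by
    rw [← fromBlocks_toBlocks W.1, J, fromBlocks_multiply, fromBlocks_multiply] at h
    have h11 := congrArg toBlocks₁₁ h
    have h21 := congrArg toBlocks₂₁ h
    simp only [toBlocks_fromBlocks₁₁, toBlocks_fromBlocks₂₁] at h11 h21
    simp only [Matrix.zero_mul, Matrix.neg_mul, Matrix.one_mul, Matrix.mul_zero, Matrix.mul_one,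
      zero_add, add_zero] at h11 h21
    rw [holPart, cx, frame_conjTranspose, frame]
    conv_lhs => rw [← fromBlocks_toBlocks W.1, fromBlocks_map]
    rw [fromCols_mul_fromBlocks, fromCols_mul_fromRows, ← h21, ← h11]
    ext i j
    simp [← mul_assoc, mul_add]
    ring_nf
  rw [hP, complexDet]

end ComplexParts

/-! ### The causal cone and positivity of the logarithmic derivative. -/

section Cone

open scoped MatrixOrder

variable {n : ℕ}

theorem omega_mulVec_eq (X : Matrix (Fin n ⊕ Fin n) (Fin n ⊕ Fin n) ℝ) (u v : Fin n ⊕ Fin n → ℝ) :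
    omega u (X *ᵥ v) = u ⬝ᵥ (-(J (Fin n) ℝ * X) *ᵥ v) := by
  rw [omega, ← vecMul_transpose, ← dotProduct_mulVec, J_transpose, mulVec_mulVec, Matrix.neg_mul]

theorem continuous_omega_mulVec (u v : Fin n ⊕ Fin n → ℝ) :
    Continuous fun X : Matrix (Fin n ⊕ Fin n) (Fin n ⊕ Fin n) ℝ => omega u (X *ᵥ v) :=
  continuous_const.dotProduct (continuous_id.matrix_mulVec continuous_const)

theorem omega_J_mulVec_pos {u : Fin n ⊕ Fin n → ℝ} (hu : u ≠ 0) :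
    0 < omega u (J (Fin n) ℝ *ᵥ u) := by
  rw [omega_mulVec_eq, J_squared, neg_neg, one_mulVec]
  exact lt_of_le_of_ne (dotProduct_self_star_nonneg u)
    fun h => hu (dotProduct_self_eq_zero.1 h.symm)

/-- For the converse, `J₀` itself lies in the open cone, so `X + εJ₀` does for `ε > 0`. -/
theorem mem_closure_spPlus {X : Matrix (Fin n ⊕ Fin n) (Fin n ⊕ Fin n) ℝ} :
    X ∈ closure (spPlus n) ↔
      (∀ u v, omega u (X *ᵥ v) = omega v (X *ᵥ u)) ∧ ∀ u, 0 ≤ omega u (X *ᵥ u) := by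
  constructor
  · intro h
    have hclosed : IsClosed {X : Matrix (Fin n ⊕ Fin n) (Fin n ⊕ Fin n) ℝ |
        (∀ u v, omega u (X *ᵥ v) = omega v (X *ᵥ u)) ∧ ∀ u, 0 ≤ omega u (X *ᵥ u)} := by
      rw [Set.ofPred_and, Set.ofPred_forall, Set.ofPred_forall]
      refine IsClosed.inter (isClosed_iInter fun u => ?_) (isClosed_iInter fun u => ?_)
      · rw [Set.ofPred_forall]
        exact isClosed_iInter fun v =>
          isClosed_eq (continuous_omega_mulVec u v) (continuous_omega_mulVec v u)
      · exact isClosed_le continuous_const (continuous_omega_mulVec u u)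
    refine closure_minimal ?_ hclosed h
    rintro Y ⟨h1, h2⟩
    refine ⟨h1, fun u => ?_⟩
    rcases eq_or_ne u 0 with rfl | hu
    · simp [omega]
    · exact (h2 u hu).le
  · rintro ⟨h1, h2⟩
    have hlim : Filter.Tendsto (fun ε : ℝ => X + ε • J (Fin n) ℝ) (nhdsWithin 0 (Set.Ioi 0))
        (nhds X) := by
      have hc : Continuous fun ε : ℝ => X + ε • J (Fin n) ℝ := by fun_prop
      simpa using (hc.tendsto 0).mono_left nhdsWithin_le_nhds
    refine mem_closure_of_tendsto hlim ?_
    filter_upwards [self_mem_nhdsWithin] with ε hε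
    have hadd : ∀ u v, omega u ((X + ε • J (Fin n) ℝ) *ᵥ v) =
        omega u (X *ᵥ v) + ε * omega u (J (Fin n) ℝ *ᵥ v) := fun u v => by
      simp [omega, add_mulVec, smul_mulVec, dotProduct_add]
    refine ⟨fun u v => ?_, fun u hu => ?_⟩
    · have hJ : omega u (J (Fin n) ℝ *ᵥ v) = omega v (J (Fin n) ℝ *ᵥ u) := dotProduct_comm _ _
      rw [hadd, hadd, h1, hJ]
    · rw [hadd]
      have := mul_pos (Set.mem_Ioi.1 hε) (omega_J_mulVec_pos hu)
      linarith [h2 u]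

theorem omega_mulVec_mulVec (W : Sp n) (u v : Fin n ⊕ Fin n → ℝ) :
    omega (W.1 *ᵥ u) (W.1 *ᵥ v) = omega u v := by
  have h := SymplecticGroup.mem_iff'.1 W.2
  rw [omega_mulVec_eq, ← vecMul_transpose W.1 u, ← dotProduct_mulVec, mulVec_mulVec,
    Matrix.mul_neg, ← Matrix.mul_assoc, h]
  simpa using (omega_mulVec_eq 1 u v).symm

theorem omega_conj_mulVec (W : Sp n) (X : Matrix (Fin n ⊕ Fin n) (Fin n ⊕ Fin n) ℝ)
    (u v : Fin n ⊕ Fin n → ℝ) :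
    omega u ((W.1 * X * (W⁻¹).1) *ᵥ v) = omega ((W⁻¹).1 *ᵥ u) (X *ᵥ ((W⁻¹).1 *ᵥ v)) := by
  have h : W.1 * (W⁻¹).1 = 1 := congrArg Subtype.val (mul_inv_cancel W)
  conv_lhs => rw [← one_mulVec u, ← h, ← mulVec_mulVec, Matrix.mul_assoc, ← mulVec_mulVec,
    omega_mulVec_mulVec, ← mulVec_mulVec]

theorem conj_mem_causalCone (W : Sp n) {X : Matrix (Fin n ⊕ Fin n) (Fin n ⊕ Fin n) ℝ}
    (hX : X ∈ causalCone n) : W.1 * X * (W⁻¹).1 ∈ causalCone n := by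
  obtain ⟨h1, h2⟩ := mem_closure_spPlus.1 hX.1
  refine ⟨mem_closure_spPlus.2 ⟨fun u v => ?_, fun u => ?_⟩, fun h0 => hX.2 ?_⟩
  · rw [omega_conj_mulVec, omega_conj_mulVec, h1]
  · rw [omega_conj_mulVec]
    exact h2 _
  · have h : (W⁻¹).1 * W.1 = 1 := congrArg Subtype.val (inv_mul_cancel W)
    have h3 : (W⁻¹).1 * (W.1 * X * (W⁻¹).1) * W.1 = X := by
      rw [Matrix.mul_assoc, Matrix.mul_assoc (W.1 * X), h, Matrix.mul_one, ← Matrix.mul_assoc, h,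
        Matrix.one_mul]
    rw [Set.mem_singleton_iff] at h0 ⊢
    rw [← h3, h0]
    simp

/-- A symplectic endomorphism is `J₀` times a Gram matrix when it lies in the closed cone. -/
theorem exists_eq_J_mul_transpose_mul_self {X : Matrix (Fin n ⊕ Fin n) (Fin n ⊕ Fin n) ℝ}
    (hX : X ∈ closure (spPlus n)) :
    ∃ B : Matrix (Fin n ⊕ Fin n) (Fin n ⊕ Fin n) ℝ, X = J (Fin n) ℝ * (Bᵀ * B) := by
  obtain ⟨h1, h2⟩ := mem_closure_spPlus.1 hX
  have hpos : (-(J (Fin n) ℝ * X)).PosSemidef := by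
    refine PosSemidef.of_dotProduct_mulVec_nonneg ?_ fun u => ?_
    · ext i j
      have := h1 (Pi.single j 1) (Pi.single i 1)
      simp only [omega_mulVec_eq] at this
      simpa using this
    · have := h2 u
      rw [omega_mulVec_eq] at this
      simpa using this
  obtain ⟨B, hB⟩ := CStarAlgebra.nonneg_iff_eq_star_mul_self.1 hpos.nonneg
  refine ⟨B, ?_⟩
  rw [star_eq_conjTranspose] at hB
  rw [← conjTranspose_eq_transpose_of_trivial, ← hB, Matrix.mul_neg, ← Matrix.mul_assoc, J_squared,
    Matrix.neg_mul, neg_neg, Matrix.one_mul]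

/-- The point is that the sum is nonzero: if `X + Y = 0`, both nonnegative forms vanish, and `X =
J₀BᵀB` with `|Bu|² = 0` for all `u`. -/
theorem add_mem_causalCone {X Y : Matrix (Fin n ⊕ Fin n) (Fin n ⊕ Fin n) ℝ}
    (hX : X ∈ causalCone n) (hY : Y ∈ causalCone n) : X + Y ∈ causalCone n := by
  obtain ⟨h1, h2⟩ := mem_closure_spPlus.1 hX.1
  obtain ⟨h3, h4⟩ := mem_closure_spPlus.1 hY.1
  have hadd : ∀ u v, omega u ((X + Y) *ᵥ v) = omega u (X *ᵥ v) + omega u (Y *ᵥ v) := fun u v => by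
    simp [omega, add_mulVec, dotProduct_add]
  refine ⟨mem_closure_spPlus.2 ⟨fun u v => ?_, fun u => ?_⟩, fun h0 => hX.2 ?_⟩
  · rw [hadd, hadd, h1, h3]
  · rw [hadd]
    exact add_nonneg (h2 u) (h4 u)
  · rw [Set.mem_singleton_iff] at h0 ⊢
    obtain ⟨B, rfl⟩ := exists_eq_J_mul_transpose_mul_self hX.1
    have hB : ∀ u, B *ᵥ u = 0 := by
      intro u
      have h5 := hadd u u
      rw [h0] at h5
      have h6 : omega u ((J (Fin n) ℝ * (Bᵀ * B)) *ᵥ u) = (B *ᵥ u) ⬝ᵥ (B *ᵥ u) := by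
        rw [omega_mulVec_eq, ← Matrix.mul_assoc, J_squared, Matrix.neg_mul, neg_neg,
          Matrix.one_mul, ← mulVec_mulVec, dotProduct_mulVec, vecMul_transpose]
      have h7 : omega u ((0 : Matrix (Fin n ⊕ Fin n) (Fin n ⊕ Fin n) ℝ) *ᵥ u) = 0 := by
        simp [omega]
      have h8 := h2 u
      have h9 := h4 u
      refine dotProduct_self_eq_zero.1 ?_
      rw [← h6]
      linarith
    have : B = 0 := by
      ext i j
      simpa using congrFun (hB (Pi.single j 1)) i
    rw [this]
    simp

theorem holPart_J_mul (S : Matrix (Fin n ⊕ Fin n) (Fin n ⊕ Fin n) ℝ) :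
    holPart (J (Fin n) ℝ * S) = Complex.I • holPart S := by
  rw [holPart, holPart, cx, Matrix.map_mul, Matrix.map_J, ← Matrix.mul_assoc, frameH_mul_J]
  simp [smul_smul, mul_comm]

theorem sqNorm_antiPart_mul_inv_lt (W : Sp n) {x : Fin n → ℂ} (hx : x ≠ 0) :
    sqNorm ((antiPart W.1 * (holPart W.1)⁻¹) *ᵥ x) < sqNorm x := by
  have hdet : IsUnit (holPart W.1).det := (det_holPart_ne_zero W).isUnit
  have h := sqNorm_holPart_sub W ((holPart W.1)⁻¹ *ᵥ x)
  rw [mulVec_mulVec, mulVec_mulVec, mul_nonsing_inv _ hdet, one_mulVec] at h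
  have h2 : (holPart W.1)⁻¹ *ᵥ x ≠ 0 := fun h0 => hx <| by
    have := congrArg (holPart W.1 *ᵥ ·) h0
    simpa [mulVec_mulVec, mul_nonsing_inv _ hdet] using this
  have h3 : sqNorm ((holPart W.1)⁻¹ *ᵥ x) ≠ 0 := fun h0 => h2 (sqNorm_eq_zero.1 h0)
  have h4 := lt_of_le_of_ne (sqNorm_nonneg _) h3.symm
  linarith

/-- The logarithmic derivative of the determinant of the complex linear part has positive
imaginary part in causal directions. -/
theorem im_trace_pos (W : Sp n) {X : Matrix (Fin n ⊕ Fin n) (Fin n ⊕ Fin n) ℝ}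
    (hX : X ∈ causalCone n) :
    0 < ((holPart W.1)⁻¹ * holPart (X * W.1)).trace.im := by
  obtain ⟨B, rfl⟩ := exists_eq_J_mul_transpose_mul_self hX.1
  have hB : B ≠ 0 := by
    rintro rfl
    exact hX.2 (by simp)
  have hdet : IsUnit (holPart W.1).det := (det_holPart_ne_zero W).isUnit
  set Z := antiPart W.1 * (holPart W.1)⁻¹ with hZ
  set G := cx B * frame n with hG
  have hGH : (frame n)ᴴ * cx Bᵀ = Gᴴ := by
    rw [hG, conjTranspose_mul]
    congr 1
    ext i j
    simp [cx]
  have hGc : cx B * coframe n = G.map star := by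
    ext i j
    simp [hG, coframe, frame, cx, Matrix.mul_apply, Matrix.one_apply, apply_ite]
  have h1 : ((holPart W.1)⁻¹ * holPart (J (Fin n) ℝ * (Bᵀ * B) * W.1)).trace =
      (Complex.I / 2) * ((Gᴴ * G).trace + (Gᴴ * (G.map star * Z)).trace) := by
    rw [trace_mul_comm, Matrix.mul_assoc, holPart_J_mul, holPart, cx, Matrix.map_mul,
      Matrix.map_mul, Matrix.mul_assoc, Matrix.mul_assoc, Matrix.mul_assoc, cx_mul_frame,
      ← Matrix.mul_assoc (frame n)ᴴ, hGH, Matrix.mul_add, ← Matrix.mul_assoc,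
      ← Matrix.mul_assoc (B.map _), ← hG, hGc, smul_smul, Matrix.smul_mul, trace_smul,
      Matrix.mul_assoc Gᴴ, Matrix.add_mul, Matrix.mul_assoc G, mul_nonsing_inv _ hdet,
      Matrix.mul_one, Matrix.mul_assoc (G.map star), ← hZ, Matrix.mul_add, trace_add, smul_eq_mul]
    ring
  have h2 : (Gᴴ * G).trace = ∑ k, ((sqNorm fun j => star (G k j) : ℝ) : ℂ) := by
    rw [trace_mul_comm]
    simp [trace, Matrix.mul_apply, sqNorm, Complex.normSq_eq_conj_mul_self, mul_comm]
  have h3 : (Gᴴ * (G.map star * Z)).trace =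
      ∑ k, (fun j => star (G k j)) ⬝ᵥ (Z *ᵥ fun j => star (G k j)) := by
    rw [trace_mul_comm, Matrix.mul_assoc]
    simp [trace, Matrix.mul_apply, dotProduct, mulVec]
  rw [h1, h2, h3, ← Finset.sum_add_distrib]
  have h4 : ∀ c : ℂ, (Complex.I / 2 * c).im = c.re / 2 := fun c => by
    simp [Complex.mul_im]
    ring
  rw [h4, Complex.re_sum]
  -- `Z` is a strict contraction, so `|x|²` outweighs `Re (x · Zx)` for each conjugated row `x` of
  -- `G`.
  have h5 : ∀ x : Fin n → ℂ, 0 ≤ (((sqNorm x : ℝ) : ℂ) + x ⬝ᵥ (Z *ᵥ x)).re ∧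
      (x ≠ 0 → 0 < (((sqNorm x : ℝ) : ℂ) + x ⬝ᵥ (Z *ᵥ x)).re) := by
    intro x
    have h6 := neg_le_re_dotProduct x (Z *ᵥ x)
    rw [Complex.add_re, Complex.ofReal_re]
    rcases eq_or_ne x 0 with rfl | hx
    · simp [sqNorm]
    · have h7 := sqNorm_antiPart_mul_inv_lt W hx
      rw [← hZ] at h7
      have : 0 < sqNorm x + (x ⬝ᵥ (Z *ᵥ x)).re := by linarith
      exact ⟨this.le, fun _ => this⟩
  refine half_pos (Finset.sum_pos' (fun k _ => (h5 _).1) ?_)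
  by_contra hcon
  push Not at hcon
  apply hB
  -- The real and imaginary parts of the entries of `G` are, up to sign, the entries of `B`; so `G =
  -- 0` would force `B = 0`.
  have h8 : ∀ k j, G k j = 0 := by
    intro k j
    by_contra hne
    refine (hcon k (Finset.mem_univ k)).not_gt ((h5 _).2 fun h0 => hne ?_)
    simpa using congrFun h0 j
  ext k j
  rcases j with j | j
  · have := congrArg Complex.re (h8 k j)
    simpa [hG, frame, cx, Matrix.mul_apply, Matrix.one_apply, apply_ite] using this
  · have := congrArg Complex.im (h8 k j)
    simpa [hG, frame, cx, Matrix.mul_apply, Matrix.one_apply, apply_ite] using this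

end Cone

/-! ### Continuous logarithms and the bound on the argument of `det (1 + C)`. -/

section Lifting

open unitInterval

theorem exists_log_lift {A : Type*} [TopologicalSpace A] (h : C(I × A, ℂ)) (h0 : ∀ x, h x ≠ 0)
    (h1 : ∀ a, h (0, a) = 1) :
    ∃ F : C(I × A, ℂ), (∀ x, Complex.exp (F x) = h x) ∧ ∀ a, F (0, a) = 0 := by
  let H : C(I × A, {z : ℂ // z ≠ 0}) := ⟨fun x => ⟨h x, h0 x⟩, by fun_prop⟩
  have H0 : ∀ a, H (0, a) = ⟨_, Complex.exp_ne_zero ((0 : C(A, ℂ)) a)⟩ := fun a => by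
    ext; simp [H, h1]
  refine ⟨Complex.isCoveringMap_exp.liftHomotopy H 0 H0, fun x => ?_, fun a => ?_⟩
  · have := congrFun (Complex.isCoveringMap_exp.liftHomotopy_lifts H 0 H0) x
    exact congrArg Subtype.val this
  · exact Complex.isCoveringMap_exp.liftHomotopy_zero H 0 H0 a

theorem log_lift_unique {X : Type*} [TopologicalSpace X] [PreconnectedSpace X] {F G : X → ℂ}
    (hF : Continuous F) (hG : Continuous G) (h : ∀ x, Complex.exp (F x) = Complex.exp (G x))
    {x₀ : X} (h0 : F x₀ = G x₀) (x : X) : F x = G x :=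
  congrFun (Complex.isCoveringMap_exp.eq_of_comp_eq hF hG
    (funext fun x => Subtype.ext (h x)) x₀ h0) x

variable {n : ℕ}

/-- The matrices `C` such that `1 + s C` is invertible for all `s ∈ [0, 1]`. -/
def starInvertible (n : ℕ) : Set (Matrix (Fin n) (Fin n) ℂ) :=
  {C | ∀ s : I, (1 + ((s : ℝ) : ℂ) • C).det ≠ 0}

theorem zero_mem_starInvertible : (0 : Matrix (Fin n) (Fin n) ℂ) ∈ starInvertible n := fun s => by
  simp

theorem det_one_add_smul_eq_prod (C : Matrix (Fin n) (Fin n) ℂ) (s : ℂ) :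
    (1 + s • C).det = (C.charpoly.roots.map fun z => 1 + s * z).prod := by
  rcases eq_or_ne s 0 with rfl | hs
  · simp
  have hsplit := IsAlgClosed.splits C.charpoly
  have h1 := hsplit.eval_eq_prod_roots_of_monic C.charpoly_monic (-s⁻¹)
  rw [eval_charpoly] at h1
  have hcard : C.charpoly.roots.card = n := by
    rw [← hsplit.natDegree_eq_card_roots, charpoly_natDegree_eq_dim, Fintype.card_fin]
  have h2 : (1 + s • C) = (-s) • (scalar (Fin n) (-s⁻¹) - C) := by
    rw [smul_sub, scalar_apply, ← smul_one_eq_diagonal, smul_smul]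
    simp [hs]
  rw [h2, det_smul, h1, Fintype.card_fin]
  nth_rw 1 [← hcard]
  rw [← Multiset.prod_replicate, ← Multiset.map_const', ← Multiset.prod_map_mul]
  refine congrArg _ (Multiset.map_congr rfl fun z _ => ?_)
  field_simp
  ring

theorem abs_im_sum_log_le (m : Multiset ℂ) :
    |((m.map Complex.log).sum).im| ≤ m.card * Real.pi := by
  induction m using Multiset.induction_on with
  | empty => simp
  | cons z m ih =>
    rw [Multiset.map_cons, Multiset.sum_cons, Complex.add_im, Multiset.card_cons]
    have h1 : |(Complex.log z).im| ≤ Real.pi := by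
      rw [Complex.log_im]; exact Complex.abs_arg_le_pi z
    push_cast
    linarith [abs_add_le (Complex.log z).im ((m.map Complex.log).sum).im]

/-- The logarithm is continued along `s ↦ 1 + sC`. Each factor `1 + sz`, with `z` an eigenvalue,
stays in the slit plane, so the continuation is the sum of `n` principal logarithms, each with
imaginary part at most `π` in absolute value. -/
theorem exists_starInvertible_log (n : ℕ) :
    ∃ ℓ : C(starInvertible n, ℂ), (∀ C, Complex.exp (ℓ C) = (1 + C.1).det) ∧
      ℓ ⟨0, zero_mem_starInvertible⟩ = 0 ∧ ∀ C, |(ℓ C).im| ≤ n * Real.pi := by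
  let h : C(I × starInvertible n, ℂ) :=
    ⟨fun x => (1 + ((x.1 : ℝ) : ℂ) • x.2.1).det, by fun_prop⟩
  obtain ⟨F, hF, hF0⟩ := exists_log_lift h (fun x => x.2.2 x.1) (fun C => by simp [h])
  refine ⟨F.comp ⟨fun C => (1, C), by fun_prop⟩, fun C => ?_, ?_, fun C => ?_⟩
  · simpa [h] using hF (1, C)
  · refine log_lift_unique (X := I) (F := fun s => F (s, ⟨0, zero_mem_starInvertible⟩))
      (G := fun _ => 0) (by fun_prop) (by fun_prop) (fun s => ?_) (x₀ := 0) (hF0 _) 1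
    rw [hF]
    simp [h]
  · have hslit : ∀ z ∈ C.1.charpoly.roots, ∀ s : I, 1 + ((s : ℝ) : ℂ) * z ∈ Complex.slitPlane := by
      intro z hz s
      by_contra hcon
      obtain ⟨r, hr, hr'⟩ : ∃ r : ℝ, 0 ≤ r ∧ 1 + ((s : ℝ) : ℂ) * z = -r := by
        rw [Complex.mem_slitPlane_iff] at hcon
        push Not at hcon
        exact ⟨-(1 + ((s : ℝ) : ℂ) * z).re, by linarith [hcon.1],
          Complex.ext (by simp) (by simpa using hcon.2)⟩
      -- If `1 + sz = -r`, then `1 + s'z = 0` for `s' = s / (1 + r)`.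
      have hs' : (s : ℝ) / (1 + r) ∈ I :=
        ⟨div_nonneg s.2.1 (by linarith), (div_le_one (by linarith)).2 (by linarith [s.2.2])⟩
      refine C.2 ⟨_, hs'⟩ ?_
      rw [det_one_add_smul_eq_prod]
      refine Multiset.prod_eq_zero (Multiset.mem_map.2 ⟨z, hz, ?_⟩)
      have h1r : (1 + (r : ℂ)) ≠ 0 := by
        have : (1 + r : ℝ) ≠ 0 := by linarith
        exact_mod_cast this
      have h2 : ((s : ℝ) : ℂ) * z = -(1 + r) := by linear_combination hr'
      push_cast
      rw [div_mul_eq_mul_div, h2, neg_div, div_self h1r, add_neg_cancel]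
    let G : I → ℂ := fun s =>
      (C.1.charpoly.roots.map fun z => Complex.log (1 + ((s : ℝ) : ℂ) * z)).sum
    have hG : Continuous G := by
      refine continuous_multiset_sum _ fun z hz => ?_
      exact Continuous.clog (by fun_prop) fun s => hslit z hz s
    have hFG : F (1, C) = G 1 := by
      refine log_lift_unique (X := I) (F := fun s => F (s, C)) (by fun_prop) hG (fun s => ?_)
        (x₀ := 0) ?_ 1
      · rw [hF, Complex.exp_multiset_sum, Multiset.map_map]
        change (1 + ((s : ℝ) : ℂ) • C.1).det = _
        rw [det_one_add_smul_eq_prod]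
        refine congrArg _ (Multiset.map_congr rfl fun z hz => ?_)
        exact (Complex.exp_log (Complex.slitPlane_ne_zero (hslit z hz s))).symm
      · simp [hF0, G]
    have hcard : C.1.charpoly.roots.card = n := by
      rw [← (IsAlgClosed.splits C.1.charpoly).natDegree_eq_card_roots, charpoly_natDegree_eq_dim,
        Fintype.card_fin]
    have := abs_im_sum_log_le (C.1.charpoly.roots.map fun z => 1 + ((1 : I) : ℝ) * z)
    rw [Multiset.map_map, Multiset.card_map, hcard] at this
    change |(F (1, C)).im| ≤ _
    rw [hFG]
    exact this


/-! ### The unitary angle on the universal cover. -/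

theorem continuous_cx : Continuous (cx (n := n)) := by
  unfold cx
  exact continuous_id.matrix_map Complex.continuous_ofReal

theorem continuous_holPart : Continuous (holPart (n := n)) := by
  unfold holPart
  refine Continuous.const_smul ?_ (1 / 2 : ℂ)
  exact (continuous_const.matrix_mul continuous_cx).matrix_mul continuous_const

theorem continuous_antiPart : Continuous (antiPart (n := n)) := by
  unfold antiPart
  refine Continuous.const_smul ?_ (1 / 2 : ℂ)
  exact (continuous_const.matrix_mul continuous_cx).matrix_mul continuous_const

theorem continuous_coantiPart : Continuous (coantiPart (n := n)) := by
  unfold coantiPart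
  refine Continuous.const_smul ?_ (1 / 2 : ℂ)
  exact (continuous_const.matrix_mul continuous_cx).matrix_mul continuous_const

/-- The correction term in the multiplicativity of `W ↦ det (holPart W)`. -/
noncomputable def correction (V W : Sp n) : Matrix (Fin n) (Fin n) ℂ :=
  (holPart V.1)⁻¹ * coantiPart V.1 * (antiPart W.1 * (holPart W.1)⁻¹)

theorem holPart_mul_one_add_correction (V W : Sp n) (s : ℂ) :
    holPart V.1 * (1 + s • correction V W) * holPart W.1 =
      holPart V.1 * holPart W.1 + s • (coantiPart V.1 * antiPart W.1) := by
  have hV : IsUnit (holPart V.1).det := (det_holPart_ne_zero V).isUnit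
  have hW : IsUnit (holPart W.1).det := (det_holPart_ne_zero W).isUnit
  rw [correction, Matrix.mul_add, Matrix.add_mul, Matrix.mul_one, Matrix.mul_smul,
    Matrix.smul_mul, Matrix.mul_assoc _ (coantiPart V.1), mul_nonsing_inv_cancel_left _ _ hV,
    Matrix.mul_assoc, Matrix.mul_assoc, nonsing_inv_mul _ hW, Matrix.mul_one]

theorem correction_mem (V W : Sp n) : correction V W ∈ starInvertible n := fun s h => by
  apply det_holPart_mul_add_ne_zero V W s.2
  rw [← holPart_mul_one_add_correction, det_mul, det_mul, h, mul_zero, zero_mul]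

theorem det_holPart_mul (V W : Sp n) : (holPart (V * W).1).det =
    (holPart V.1).det * (1 + correction V W).det * (holPart W.1).det := by
  have h := holPart_mul_one_add_correction V W 1
  rw [one_smul, one_smul] at h
  rw [Submonoid.coe_mul, holPart_mul, ← h, det_mul, det_mul]

theorem continuous_holPart_inv : Continuous fun W : Sp n => (holPart W.1)⁻¹ := by
  have h : (fun W : Sp n => (holPart W.1)⁻¹) =
      fun W => ((holPart W.1).det)⁻¹ • (holPart W.1).adjugate := by
    funext W
    rw [Matrix.inv_def, Ring.inverse_eq_inv']
  rw [h]
  have hc : Continuous fun W : Sp n => holPart W.1 := continuous_holPart.comp continuous_subtype_val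
  exact (hc.matrix_det.inv₀ det_holPart_ne_zero).smul hc.matrix_adjugate

theorem continuous_correction : Continuous fun x : Sp n × Sp n => correction x.1 x.2 := by
  unfold correction
  have h1 := continuous_holPart_inv (n := n)
  have h2 := (continuous_antiPart (n := n)).comp
    (continuous_subtype_val (p := (· ∈ symplecticGroup (Fin n) ℝ)))
  have h3 := (continuous_coantiPart (n := n)).comp
    (continuous_subtype_val (p := (· ∈ symplecticGroup (Fin n) ℝ)))
  exact ((h1.comp continuous_fst).matrix_mul (h3.comp continuous_fst)).matrix_mul
    ((h2.comp continuous_snd).matrix_mul (h1.comp continuous_snd))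

theorem correction_eq_zero {V W : Sp n} (hW : antiPart W.1 = 0) : correction V W = 0 := by
  simp [correction, hW]

theorem continuous_eval_basedPaths :
    Continuous fun x : I × basedPaths n => (x.2 : C(I, Sp n)) x.1 :=
  (continuous_subtype_val.comp continuous_snd).eval continuous_fst

theorem exists_pathLog (n : ℕ) : ∃ F : C(I × basedPaths n, ℂ),
    (∀ t γ, Complex.exp (F (t, γ)) = (holPart ((γ : C(I, Sp n)) t).1).det) ∧
      ∀ γ, F (0, γ) = 0 := by
  let h : C(I × basedPaths n, ℂ) := ⟨fun x => (holPart ((x.2 : C(I, Sp n)) x.1).1).det,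
    (continuous_holPart.comp (continuous_subtype_val.comp continuous_eval_basedPaths)).matrix_det⟩
  obtain ⟨F, hF, hF0⟩ := exists_log_lift h (fun x => det_holPart_ne_zero _) (fun γ => by
    have : (γ : C(I, Sp n)) 0 = 1 := γ.2
    simp [h, this])
  exact ⟨F, fun t γ => hF (t, γ), hF0⟩

/-- The continuous logarithm of `det (holPart W)` along based paths. -/
noncomputable def pathLog (n : ℕ) : C(I × basedPaths n, ℂ) := (exists_pathLog n).choose

theorem exp_pathLog (t : I) (γ : basedPaths n) :
    Complex.exp (pathLog n (t, γ)) = (holPart ((γ : C(I, Sp n)) t).1).det :=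
  (exists_pathLog n).choose_spec.1 t γ

theorem pathLog_zero (γ : basedPaths n) : pathLog n (0, γ) = 0 :=
  (exists_pathLog n).choose_spec.2 γ

/-- Along the homotopy the end-point is fixed, so the final logarithm is a continuous lift of a
constant. -/
theorem pathLog_eq_of_homotopicRel {γ δ : basedPaths n}
    (h : (γ : C(I, Sp n)).HomotopicRel (δ : C(I, Sp n)) {0, 1}) :
    pathLog n (1, γ) = pathLog n (1, δ) := by
  obtain ⟨H⟩ := h
  have hmem : ∀ s : I, H.toContinuousMap.curry s ∈ basedPaths n := fun s => by
    change H (s, 0) = 1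
    rw [H.eq_fst s (by simp)]
    exact γ.2
  let Γ : I → basedPaths n := fun s => ⟨H.toContinuousMap.curry s, hmem s⟩
  have hΓ : Continuous Γ := H.toContinuousMap.curry.continuous.subtype_mk hmem
  have h0 : Γ 0 = γ := Subtype.ext (ContinuousMap.ext fun t => H.apply_zero t)
  have h1 : Γ 1 = δ := Subtype.ext (ContinuousMap.ext fun t => H.apply_one t)
  have hconst := log_lift_unique (F := fun s => pathLog n (1, Γ s))
    (G := fun _ => pathLog n (1, γ)) (by fun_prop) (by fun_prop) (fun s => by
      rw [exp_pathLog, exp_pathLog]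
      have : (Γ s : C(I, Sp n)) 1 = (γ : C(I, Sp n)) 1 := H.eq_fst s (by simp)
      rw [this]) (x₀ := 0) (by rw [h0]) 1
  rw [← hconst, h1]

/-- The continuous logarithm of `det (holPart W)` on the universal cover. -/
noncomputable def coverLog (n : ℕ) : SpCover n → ℂ :=
  Quotient.lift (fun γ => pathLog n (1, γ)) fun γ δ h =>
    pathLog_eq_of_homotopicRel ((mk_eq_mk_iff γ δ).1 (Quotient.sound h))

theorem continuous_coverLog : Continuous (coverLog n) :=
  Continuous.quotient_lift (by fun_prop) _

theorem exp_coverLog (w : SpCover n) :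
    Complex.exp (coverLog n w) = (holPart (proj n w).1).det := by
  induction w using QuotientGroup.induction_on with
  | H γ => exact exp_pathLog 1 γ

/-- Both sides extend along the pointwise product of paths to continuous logarithms of the same
function, and they agree at time `0`, where the correction vanishes. -/
theorem exists_coverLog_mul (n : ℕ) : ∃ ℓ : starInvertible n → ℂ,
    ℓ ⟨0, zero_mem_starInvertible⟩ = 0 ∧ (∀ C, |(ℓ C).im| ≤ n * Real.pi) ∧
    ∀ v w : SpCover n, coverLog n (v * w) = coverLog n v + coverLog n w +
      ℓ ⟨correction (proj n v) (proj n w), correction_mem _ _⟩ := by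
  obtain ⟨ℓ, hexp, h0, hb⟩ := exists_starInvertible_log n
  refine ⟨ℓ, h0, hb, fun v w => ?_⟩
  induction v using QuotientGroup.induction_on with
  | H γ =>
  induction w using QuotientGroup.induction_on with
  | H δ =>
  let a : C(I, Sp n) := γ
  let b : C(I, Sp n) := δ
  have h1 : Continuous fun t : I =>
      (⟨correction (a t) (b t), correction_mem _ _⟩ : starInvertible n) :=
    (continuous_correction.comp (a.continuous.prodMk b.continuous)).subtype_mk _
  refine log_lift_unique (X := I) (F := fun t => pathLog n (t, γ * δ))
    (G := fun t => pathLog n (t, γ) + pathLog n (t, δ) +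
      ℓ ⟨correction (a t) (b t), correction_mem _ _⟩) (by fun_prop) (by fun_prop) (fun t => ?_)
      (x₀ := 0) ?_ 1
  · rw [Complex.exp_add, Complex.exp_add, hexp, exp_pathLog, exp_pathLog, exp_pathLog]
    refine (det_holPart_mul (a t) (b t)).trans ?_
    ring
  · simp only [pathLog_zero, zero_add]
    have hb0 : b 0 = 1 := δ.2
    have : (⟨correction (a 0) (b 0), correction_mem _ _⟩ : starInvertible n) =
        ⟨0, zero_mem_starInvertible⟩ :=
      Subtype.ext (correction_eq_zero (by rw [hb0]; exact antiPart_one))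
    rw [this, h0]

/-- The unitary angle on the universal cover, measured in turns. -/
noncomputable def angle (w : SpCover n) : ℝ := (coverLog n w).im / (2 * Real.pi)

theorem continuous_angle : Continuous (angle (n := n)) :=
  (Complex.continuous_im.comp continuous_coverLog).div_const _

theorem abs_angle_mul_sub_le (v w : SpCover n) :
    |angle (v * w) - angle v - angle w| ≤ n / 2 := by
  obtain ⟨ℓ, -, hb, hm⟩ := exists_coverLog_mul n
  have h := hb ⟨correction (proj n v) (proj n w), correction_mem _ _⟩
  have hpi := Real.pi_pos
  simp only [angle, hm, Complex.add_im]
  rw [← sub_div, ← sub_div, abs_div, abs_of_pos (by positivity : 0 < 2 * Real.pi),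
    div_le_iff₀ (by positivity)]
  calc _ = |(ℓ ⟨correction (proj n v) (proj n w), correction_mem _ _⟩).im| := by congr 1; ring
    _ ≤ n * Real.pi := h
    _ = _ := by ring

/-- A unitary right factor has no antilinear part, so the correction vanishes. -/
theorem angle_mul_of_mem {v w : SpCover n} (hw : proj n w ∈ unitarySet n) :
    angle (v * w) = angle v + angle w := by
  obtain ⟨ℓ, h0, -, hm⟩ := exists_coverLog_mul n
  have : (⟨correction (proj n v) (proj n w), correction_mem _ _⟩ : starInvertible n) =
      ⟨0, zero_mem_starInvertible⟩ := Subtype.ext (correction_eq_zero (antiPart_eq_zero hw))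
  rw [angle, hm, this, h0, add_zero, Complex.add_im, add_div, angle, angle]

theorem angle_one : angle (1 : SpCover n) = 0 := by
  have h1 : proj n (1 : SpCover n) ∈ unitarySet n := by
    rw [map_one]
    exact one_mem (orthogonalGroup (Fin n ⊕ Fin n) ℝ)
  have := angle_mul_of_mem (v := (1 : SpCover n)) h1
  rw [mul_one] at this
  linarith

theorem angle_pow_of_mem {w : SpCover n} (hw : proj n w ∈ unitarySet n) (k : ℕ) :
    angle (w ^ k) = k * angle w := by
  induction k with
  | zero => simp [angle_one]
  | succ k ih =>
    rw [pow_succ, angle_mul_of_mem hw, ih]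
    push_cast
    ring

theorem norm_det_holPart_of_mem {W : Sp n} (hW : W ∈ unitarySet n) :
    ‖(holPart W.1).det‖ = 1 := by
  have h1 : star W.1 * W.1 = 1 := (mem_orthogonalGroup_iff' _ _).1 hW
  have h2 : holPart (star W.1) = (holPart W.1)ᴴ := by
    have : cx (star W.1) = (cx W.1)ᴴ := by
      ext i j; simp [cx]
    rw [holPart, holPart, this, conjTranspose_smul, conjTranspose_mul, conjTranspose_mul,
      conjTranspose_conjTranspose, Matrix.mul_assoc]
    simp
  have h3 := holPart_mul (star W.1) W.1
  rw [h1, antiPart_eq_zero hW, Matrix.mul_zero, add_zero, holPart_one, h2] at h3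
  have h4 := congrArg (fun M => ‖Matrix.det M‖) h3
  simp only [det_one, norm_one, det_mul, det_conjTranspose, norm_mul, norm_star] at h4
  nlinarith [norm_nonneg (holPart W.1).det]

theorem exp_angle_of_mem {w : SpCover n} (hw : proj n w ∈ unitarySet n) :
    Complex.exp (2 * Real.pi * Complex.I * (angle w : ℂ)) = complexDet (proj n w) := by
  have h1 := exp_coverLog w
  have h2 : (coverLog n w).re = 0 := by
    have h3 := norm_det_holPart_of_mem hw
    rwa [← h1, Complex.norm_exp, Real.exp_eq_one_iff] at h3
  rw [← det_holPart_eq_complexDet hw, ← h1]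
  congr 1
  have hpi : (Real.pi : ℂ) ≠ 0 := by exact_mod_cast Real.pi_ne_zero
  rw [← Complex.re_add_im (coverLog n w), h2, angle]
  push_cast
  field_simp
  simp

end Lifting

instance instIsTopologicalGroupPaths (n : ℕ) : IsTopologicalGroup C(unitInterval, Sp n) where
  continuous_inv := ContinuousMap.continuous_postcomp ⟨_, continuous_inv⟩

/-! ### Monotonicity along causal curves. -/

section TimeFunction

variable {n : ℕ}

/-- Jacobi's formula. -/
theorem hasDerivWithinAt_det {m : Type*} [Fintype m] [DecidableEq m] {A : ℝ → Matrix m m ℂ}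
    {A' : Matrix m m ℂ} {s : Set ℝ} {t : ℝ}
    (h : ∀ i j, HasDerivWithinAt (fun τ => A τ i j) (A' i j) s t) :
    HasDerivWithinAt (fun τ => (A τ).det) ((A t).adjugate * A').trace s t := by
  simp only [det_apply']
  have h1 : HasDerivWithinAt
      (fun τ => ∑ σ : Equiv.Perm m, ((Equiv.Perm.sign σ : ℤ) : ℂ) * ∏ i, A τ (σ i) i)
      (∑ σ : Equiv.Perm m, ((Equiv.Perm.sign σ : ℤ) : ℂ) *
        ∑ i, (∏ j ∈ Finset.univ.erase i, A t (σ j) j) • A' (σ i) i) s t :=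
    HasDerivWithinAt.fun_sum fun σ _ =>
      (HasDerivWithinAt.fun_finsetProd fun i _ => h (σ i) i).const_mul _
  refine h1.congr_deriv ?_
  have h2 : ((A t).adjugate * A').trace = ∑ i, ((A t).updateCol i fun j => A' j i).det := by
    refine Finset.sum_congr rfl fun i _ => ?_
    rw [← cramer_apply, cramer_eq_adjugate_mulVec]
    rfl
  rw [h2]
  simp only [det_apply', Finset.mul_sum]
  rw [Finset.sum_comm]
  refine Finset.sum_congr rfl fun i _ => Finset.sum_congr rfl fun σ _ => ?_
  rw [← Finset.mul_prod_erase _ _ (Finset.mem_univ i), updateCol_self, smul_eq_mul,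
    mul_comm (A' (σ i) i)]
  congr 2
  refine Finset.prod_congr rfl fun j hj => ?_
  rw [updateCol_ne (Finset.ne_of_mem_erase hj)]

theorem hasDerivWithinAt_holPart {W : ℝ → Matrix (Fin n ⊕ Fin n) (Fin n ⊕ Fin n) ℝ}
    {W' : Matrix (Fin n ⊕ Fin n) (Fin n ⊕ Fin n) ℝ} {s : Set ℝ} {t : ℝ}
    (h : ∀ i j, HasDerivWithinAt (fun τ => W τ i j) (W' i j) s t) (i j : Fin n) :
    HasDerivWithinAt (fun τ => holPart (W τ) i j) (holPart W' i j) s t := by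
  simp only [holPart, cx, Matrix.smul_apply, Matrix.mul_apply, Matrix.map_apply, smul_eq_mul]
  refine HasDerivWithinAt.const_mul _ (HasDerivWithinAt.fun_sum fun k _ => ?_)
  refine HasDerivWithinAt.mul_const ?_ _
  exact HasDerivWithinAt.fun_sum fun l _ => ((h l k).ofReal_comp).const_mul _

/-- Near `t` continuity keeps `c - c t` in the strip of the principal logarithm, so `c = c t + log
(d / d t)` there. -/
theorem hasDerivWithinAt_of_exp_eq {c d : ℝ → ℂ} {d' : ℂ} {s : Set ℝ} {t : ℝ}
    (hc : ContinuousWithinAt c s t) (hd : HasDerivWithinAt d d' s t)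
    (h : ∀ τ, Complex.exp (c τ) = d τ) : HasDerivWithinAt c (d' / d t) s t := by
  have hne : d t ≠ 0 := by rw [← h]; exact Complex.exp_ne_zero _
  have h1 : HasDerivWithinAt (fun τ => c t + Complex.log (d τ / d t)) (d' / d t) s t := by
    have h2 := (hd.div_const (d t)).clog_real (by simp [div_self hne])
    rw [div_self hne, div_one] at h2
    exact h2.const_add _
  refine h1.congr_of_eventuallyEq ?_ (by simp [div_self hne])
  have h3 : Filter.Tendsto (fun τ => (c τ - c t).im) (nhdsWithin t s) (nhds 0) := by
    have := (Complex.continuous_im.tendsto _).comp (hc.tendsto.sub_const (c t))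
    simpa using! this
  filter_upwards [h3.eventually_lt_const Real.pi_pos,
    h3.eventually_const_lt (neg_lt_zero.2 Real.pi_pos)] with τ h4 h5
  rw [← h, ← h t, ← Complex.exp_sub, Complex.log_exp h5 h4.le]
  ring

theorem continuous_proj : Continuous (proj n) :=
  Continuous.quotient_lift
    ((continuous_eval_basedPaths (n := n)).comp (Continuous.prodMk_right (1 : unitInterval))) _

/-- The logarithmic derivative of `VW` is `Y + V X V⁻¹`, causal because the cone is conjugation
invariant and closed under sums. -/
theorem IsCausalCurveOn.mul {v w : ℝ → SpCover n} {s : Set ℝ} (hv : IsCausalCurveOn v s)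
    (hw : IsCausalCurveOn w s) : IsCausalCurveOn (fun t => v t * w t) s := by
  obtain ⟨hvc, Y, hYc, hY, hYd⟩ := hv
  obtain ⟨hwc, X, hXc, hX, hXd⟩ := hw
  have hV : ContinuousOn (fun t => (proj n (v t)).1) s :=
    (continuous_subtype_val.comp continuous_proj).comp_continuousOn hvc
  have hV' : ContinuousOn (fun t => ((proj n (v t))⁻¹).1) s :=
    (continuous_subtype_val.comp (continuous_inv.comp continuous_proj)).comp_continuousOn hvc
  refine ⟨hvc.mul hwc, fun t => Y t + (proj n (v t)).1 * X t * ((proj n (v t))⁻¹).1,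
    hYc.add ((hV.mul hXc).mul hV'), fun t ht =>
      add_mem_causalCone (hY t ht) (conj_mem_causalCone _ (hX t ht)), fun t ht i j => ?_⟩
  have h1 : ((proj n (v t))⁻¹).1 * (proj n (v t)).1 = 1 :=
    congrArg Subtype.val (inv_mul_cancel (proj n (v t)))
  have h2 : (Y t + (proj n (v t)).1 * X t * ((proj n (v t))⁻¹).1) *
      ((proj n (v t)).1 * (proj n (w t)).1) =
      Y t * (proj n (v t)).1 * (proj n (w t)).1 + (proj n (v t)).1 * (X t * (proj n (w t)).1) := by
    rw [Matrix.add_mul, ← Matrix.mul_assoc, ← Matrix.mul_assoc _ (proj n (v t)).1,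
      Matrix.mul_assoc _ _ (proj n (v t)).1, h1, Matrix.mul_one, Matrix.mul_assoc _ (X t)]
  simp only [map_mul, Submonoid.coe_mul]
  rw [h2]
  have h3 : HasDerivWithinAt (fun τ => ∑ k, (proj n (v τ)).1 i k * (proj n (w τ)).1 k j)
      (∑ k, ((Y t * (proj n (v t)).1) i k * (proj n (w t)).1 k j +
        (proj n (v t)).1 i k * (X t * (proj n (w t)).1) k j)) s t :=
    HasDerivWithinAt.fun_sum fun k _ => (hYd t ht i k).mul (hXd t ht k j)
  refine h3.congr_deriv ?_
  rw [Finset.sum_add_distrib]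
  rfl

theorem IsCausalCurveOn.pow_succ {w : ℝ → SpCover n} {s : Set ℝ} (hw : IsCausalCurveOn w s)
    (k : ℕ) : IsCausalCurveOn (fun t => w t ^ (k + 1)) s := by
  induction k with
  | zero => simpa using hw
  | succ k ih =>
    simp only [_root_.pow_succ _ (k + 1)]
    exact ih.mul hw

theorem strictMonoOn_angle {w : ℝ → SpCover n} {s : Set ℝ} (hs : s.OrdConnected)
    (hw : IsCausalCurveOn w s) : StrictMonoOn (fun t => angle (w t)) s := by
  obtain ⟨hwc, X, -, hX, hd⟩ := hw
  have hderiv : ∀ t ∈ s, HasDerivWithinAt (fun τ => angle (w τ))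
      (((holPart (proj n (w t)).1)⁻¹ * holPart (X t * (proj n (w t)).1)).trace.im / (2 * Real.pi))
      s t := by
    intro t ht
    have h1 := hasDerivWithinAt_det (hasDerivWithinAt_holPart (hd t ht))
    have h2 := hasDerivWithinAt_of_exp_eq
      ((continuous_coverLog.comp_continuousOn hwc) t ht) h1 (fun τ => exp_coverLog (w τ))
    have h3 := (Complex.imCLM.hasFDerivAt.comp_hasDerivWithinAt t h2).div_const (2 * Real.pi)
    refine h3.congr_deriv ?_
    rw [Matrix.inv_def, Ring.inverse_eq_inv', Matrix.smul_mul, trace_smul, smul_eq_mul,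
      inv_mul_eq_div]
    rfl
  refine strictMonoOn_of_hasDerivWithinAt_pos hs.convex
    (continuous_angle.comp_continuousOn hwc)
    (fun t ht => (hderiv t (interior_subset ht)).mono interior_subset) fun t ht => ?_
  exact div_pos (im_trace_pos _ (hX t (interior_subset ht))) (by positivity)

theorem isTimeFunction_angle_pow (n k : ℕ) :
    IsTimeFunction fun w : SpCover n => angle (w ^ (k + 1)) / (k + 1) := by
  refine ⟨(continuous_angle.comp (continuous_pow (k + 1))).div_const _, fun s w hs hw => ?_⟩
  intro a ha b hb hab
  exact div_lt_div_of_pos_right (strictMonoOn_angle hs (hw.pow_succ k) ha hb hab) (by positivity)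

end TimeFunction

/-! ### Polar decomposition of symplectic paths. -/

section Polar

open scoped MatrixOrder

theorem isClosed_posSemidef {m : Type*} [Fintype m] :
    IsClosed {A : Matrix m m ℝ | A.PosSemidef} := by
  have h : {A : Matrix m m ℝ | A.PosSemidef} =
      {A | Aᴴ = A} ∩ ⋂ x : m → ℝ, {A | 0 ≤ star x ⬝ᵥ (A *ᵥ x)} := by
    ext A
    simp only [Set.mem_inter_iff, Set.mem_iInter, Set.mem_ofPred_eq]
    exact posSemidef_iff_dotProduct_mulVec
  rw [h]
  refine IsClosed.inter (isClosed_eq continuous_id.matrix_conjTranspose continuous_id)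
    (isClosed_iInter fun x => isClosed_le continuous_const ?_)
  exact continuous_const.dotProduct (continuous_id.matrix_mulVec continuous_const)

/-- Positive semidefinite square roots depend continuously on the matrix. -/
theorem continuous_of_posSemidef_of_mul_self {X m : Type*} [TopologicalSpace X] [Fintype m]
    [DecidableEq m] {S p : X → Matrix m m ℝ} (hS : Continuous S) (hp : ∀ x, (p x).PosSemidef)
    (hpS : ∀ x, p x * p x = S x) : Continuous p := by
  refine continuous_iff_continuousAt.2 fun x₀ => ?_
  refine (Filter.tendsto_iff_ultrafilter _ _ _).2 fun U hU => ?_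
  -- Symmetry of `p` gives `p i j ^ 2 ≤ (p * p) i i`. The entries are thus locally bounded, every
  -- ultrafilter has a limit, and uniqueness of the positive square root identifies it.
  have hentry : ∀ x i j, p x i j ∈ Set.Icc (-(S x i i + 1)) (S x i i + 1) := by
    intro x i j
    have h1 : S x i i = ∑ k, p x i k * p x i k := by
      rw [← hpS, Matrix.mul_apply]
      refine Finset.sum_congr rfl fun k _ => ?_
      have := (hp x).1.apply i k
      rw [star_trivial] at this
      rw [this]
    have h2 : p x i j * p x i j ≤ S x i i := by
      rw [h1]
      exact Finset.single_le_sum (f := fun k => p x i k * p x i k)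
        (fun k _ => mul_self_nonneg _) (Finset.mem_univ j)
    constructor <;> nlinarith [sq_nonneg (p x i j - 1), sq_nonneg (p x i j + 1)]
  let K : Set (Matrix m m ℝ) :=
    Set.univ.pi fun i => Set.univ.pi fun _ => Set.Icc (-(S x₀ i i + 2)) (S x₀ i i + 2)
  have hK : IsCompact K := isCompact_univ_pi fun i => isCompact_univ_pi fun _ => isCompact_Icc
  have hev : ∀ᶠ x in (U : Filter X), p x ∈ K := by
    have h1 : ∀ᶠ x in nhds x₀, ∀ i, S x i i < S x₀ i i + 1 := by
      refine Filter.eventually_all.2 fun i => ?_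
      have : Continuous fun x => S x i i := hS.matrix_elem i i
      exact (this.tendsto x₀).eventually_lt_const (by linarith)
    filter_upwards [hU h1] with x hx
    intro i _ j _
    have := hentry x i j
    exact ⟨by linarith [this.1, hx i], by linarith [this.2, hx i]⟩
  obtain ⟨q, -, hq⟩ := isCompact_iff_ultrafilter_le_nhds.1 hK (U.map p)
    (Filter.le_principal_iff.2 hev)
  have hq' : Filter.Tendsto p U (nhds q) := hq
  have hqpos : q.PosSemidef :=
    isClosed_posSemidef.mem_of_tendsto hq' (Filter.Eventually.of_forall hp)
  have hqS : q * q = S x₀ := by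
    have h1 : Filter.Tendsto (fun x => p x * p x) U (nhds (q * q)) := hq'.mul hq'
    simp only [hpS] at h1
    exact tendsto_nhds_unique h1 ((hS.tendsto x₀).mono_left hU)
  have : q = p x₀ := (CFC.mul_self_eq_mul_self_iff q (p x₀) hqpos.nonneg (hp x₀).nonneg).1
    (hqS.trans (hpS x₀).symm)
  rw [← this]
  exact hq'

variable {n : ℕ}

/-- The positive semidefinite square root of a symplectic matrix is symplectic. -/
theorem mul_J_mul_eq_of_mul_self {S p : Matrix (Fin n ⊕ Fin n) (Fin n ⊕ Fin n) ℝ}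
    (hp : p.PosSemidef) (hpS : p * p = S) (hS : S * J (Fin n) ℝ * S = J (Fin n) ℝ) :
    p * J (Fin n) ℝ * p = J (Fin n) ℝ := by
  have hJJ := J_squared (Fin n) ℝ
  have hSinv : S * (-(J (Fin n) ℝ * S * J (Fin n) ℝ)) = 1 := by
    rw [Matrix.mul_neg, ← Matrix.mul_assoc, ← Matrix.mul_assoc, hS, hJJ, neg_neg]
  have hSinv' : S⁻¹ = -(J (Fin n) ℝ * S * J (Fin n) ℝ) := inv_eq_right_inv hSinv
  have hSdet : IsUnit S.det := isUnit_det_of_right_inverse hSinv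
  have hpdet : IsUnit p.det := by
    rw [← hpS, det_mul] at hSdet
    exact isUnit_of_mul_isUnit_left hSdet
  -- `-JpJ = JpJᵀ` is positive semidefinite with square `p⁻²`, so uniqueness of square roots makes
  -- it `p⁻¹`.
  have hq : (-(J (Fin n) ℝ * p * J (Fin n) ℝ)).PosSemidef := by
    have := hp.mul_mul_conjTranspose_same (J (Fin n) ℝ)
    rwa [conjTranspose_eq_transpose_of_trivial, J_transpose, Matrix.mul_neg] at this
  have hqq : (-(J (Fin n) ℝ * p * J (Fin n) ℝ)) * (-(J (Fin n) ℝ * p * J (Fin n) ℝ)) =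
      p⁻¹ * p⁻¹ := by
    rw [← Matrix.mul_inv_rev, hpS, hSinv', ← hpS]
    simp only [Matrix.mul_neg, Matrix.neg_mul, neg_neg, Matrix.mul_assoc]
    rw [← Matrix.mul_assoc (J (Fin n) ℝ) (J (Fin n) ℝ), hJJ]
    simp
  have h := (CFC.mul_self_eq_mul_self_iff _ _ hq.nonneg hp.inv.nonneg).1 hqq
  have h2 : p * (-(J (Fin n) ℝ * p * J (Fin n) ℝ)) * J (Fin n) ℝ = J (Fin n) ℝ := by
    rw [h, mul_nonsing_inv _ hpdet, Matrix.one_mul]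
  refine Eq.trans ?_ h2
  simp only [Matrix.mul_neg, Matrix.neg_mul, Matrix.mul_assoc, hJJ]
  simp

/-- Take `p = √(WᵀW)` and `u = Wp⁻¹` pointwise. The last clause lets conjugation by `J₀` invert `p`.
-/
theorem exists_polar (γ : basedPaths n) : ∃ u p : basedPaths n, γ = u * p ∧
    (∀ t, (u : C(unitInterval, Sp n)) t ∈ unitarySet n) ∧
    ∀ t, SymplecticGroup.symJ (Fin n) ℝ * (p : C(unitInterval, Sp n)) t *
      (SymplecticGroup.symJ (Fin n) ℝ)⁻¹ = ((p : C(unitInterval, Sp n)) t)⁻¹ := by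
  let W : unitInterval → Matrix (Fin n ⊕ Fin n) (Fin n ⊕ Fin n) ℝ :=
    fun t => ((γ : C(unitInterval, Sp n)) t).1
  have hWsp : ∀ t, W t ∈ symplecticGroup (Fin n) ℝ := fun t => ((γ : C(unitInterval, Sp n)) t).2
  have hWc : Continuous W := continuous_subtype_val.comp (γ : C(unitInterval, Sp n)).continuous
  have hW0 : W 0 = 1 := congrArg Subtype.val γ.2
  have hS : ∀ t, ((W t)ᵀ * W t).PosSemidef := fun t => by
    simpa using posSemidef_conjTranspose_mul_self (W t)
  let q : unitInterval → Matrix (Fin n ⊕ Fin n) (Fin n ⊕ Fin n) ℝ :=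
    fun t => CFC.sqrt ((W t)ᵀ * W t)
  have hq : ∀ t, (q t).PosSemidef := fun t => (CFC.sqrt_nonneg _).posSemidef
  have hqt : ∀ t, (q t)ᵀ = q t := fun t => by
    rw [← conjTranspose_eq_transpose_of_trivial]
    exact (hq t).1
  have hqq : ∀ t, q t * q t = (W t)ᵀ * W t := fun t => CFC.sqrt_mul_sqrt_self _ (hS t).nonneg
  have hqc : Continuous q :=
    continuous_of_posSemidef_of_mul_self (hWc.matrix_transpose.mul hWc) hq hqq
  have hqJ : ∀ t, q t * J (Fin n) ℝ * q t = J (Fin n) ℝ := fun t => by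
    refine mul_J_mul_eq_of_mul_self (hq t) (hqq t) ?_
    have h := SymplecticGroup.mem_iff.1 (mul_mem (SymplecticGroup.transpose_mem (hWsp t)) (hWsp t))
    simpa using h
  have hqsp : ∀ t, q t ∈ symplecticGroup (Fin n) ℝ := fun t =>
    SymplecticGroup.mem_iff.2 (by rw [hqt, hqJ])
  have hq0 : q 0 = 1 :=
    (CFC.mul_self_eq_mul_self_iff _ _ (hq 0).nonneg PosSemidef.one.nonneg).1 (by simp [hqq, hW0])
  let p : basedPaths n := ⟨⟨fun t => ⟨q t, hqsp t⟩, hqc.subtype_mk _⟩, Subtype.ext hq0⟩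
  refine ⟨γ * p⁻¹, p, by simp, fun t => ?_, fun t => ?_⟩
  · have h1 : (q t)⁻¹ * q t = 1 := nonsing_inv_mul _ (SymplecticGroup.symplectic_det (hqsp t))
    have h2 : q t * (q t)⁻¹ = 1 := mul_nonsing_inv _ (SymplecticGroup.symplectic_det (hqsp t))
    have h3 : ((γ * p⁻¹ : basedPaths n) : C(unitInterval, Sp n)) t =
      (γ : C(unitInterval, Sp n)) t * (⟨q t, hqsp t⟩ : Sp n)⁻¹ := rfl
    rw [h3]
    refine (mem_orthogonalGroup_iff' _ _).2 ?_
    rw [Submonoid.coe_mul, SymplecticGroup.coe_inv']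
    change (W t * (q t)⁻¹)ᵀ * (W t * (q t)⁻¹) = 1
    rw [transpose_mul, transpose_nonsing_inv, hqt, Matrix.mul_assoc, ← Matrix.mul_assoc (W t)ᵀ,
      ← hqq, Matrix.mul_assoc, h2, Matrix.mul_one, h1]
  · rw [eq_inv_iff_mul_eq_one]
    refine Subtype.ext ?_
    rw [Submonoid.coe_mul, Submonoid.coe_mul, Submonoid.coe_mul, SymplecticGroup.coe_inv',
      SymplecticGroup.coe_J, J_inv]
    change J (Fin n) ℝ * q t * -J (Fin n) ℝ * q t = 1
    rw [Matrix.mul_neg, Matrix.neg_mul, Matrix.mul_assoc, Matrix.mul_assoc,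
      ← Matrix.mul_assoc (q t), hqJ, J_squared, neg_neg]

end Polar

/-! ### Rotations and conjugation in the universal cover. -/

section Rotation

variable {n : ℕ}

theorem rotation_mem (θ : ℝ) :
    Real.cos θ • 1 + Real.sin θ • J (Fin n) ℝ ∈ symplecticGroup (Fin n) ℝ := by
  rw [SymplecticGroup.mem_iff, transpose_add, transpose_smul, transpose_smul, J_transpose,
    transpose_one]
  simp only [Matrix.add_mul, Matrix.mul_add, Matrix.smul_mul, Matrix.mul_smul, Matrix.one_mul,
    Matrix.mul_one, Matrix.mul_neg, Matrix.neg_mul, J_squared, smul_neg]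
  linear_combination (norm := module) Real.cos_sq_add_sin_sq θ • J (Fin n) ℝ

/-- Multiplication by `e^{iθ}`. -/
noncomputable def rotation (n : ℕ) (θ : ℝ) : Sp n := ⟨_, rotation_mem θ⟩

theorem continuous_rotation : Continuous (rotation n) :=
  Continuous.subtype_mk (by fun_prop) _

theorem rotation_zero : rotation n 0 = 1 := Subtype.ext (by simp [rotation])

theorem rotation_pi_div_two : rotation n (Real.pi / 2) = SymplecticGroup.symJ (Fin n) ℝ :=
  Subtype.ext (by simp [rotation])

theorem rotation_mem_unitarySet (θ : ℝ) : rotation n θ ∈ unitarySet n := by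
  refine (mem_orthogonalGroup_iff _ _).2 ?_
  change (Real.cos θ • 1 + Real.sin θ • J (Fin n) ℝ) *
    (Real.cos θ • 1 + Real.sin θ • J (Fin n) ℝ)ᵀ = 1
  rw [transpose_add, transpose_smul, transpose_smul, J_transpose, transpose_one]
  simp only [Matrix.add_mul, Matrix.mul_add, Matrix.smul_mul, Matrix.mul_smul, Matrix.one_mul,
    Matrix.mul_one, Matrix.mul_neg, J_squared, smul_neg]
  linear_combination (norm := module) Real.cos_sq_add_sin_sq θ •
    (1 : Matrix (Fin n ⊕ Fin n) (Fin n ⊕ Fin n) ℝ)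

theorem complexDet_rotation (θ : ℝ) :
    complexDet (rotation n θ) = Complex.exp (n * (θ * Complex.I)) := by
  have h : (rotation n θ).1.toBlocks₁₁.map Complex.ofReal +
      Complex.I • (rotation n θ).1.toBlocks₂₁.map Complex.ofReal =
      (Complex.exp (θ * Complex.I)) • (1 : Matrix (Fin n) (Fin n) ℂ) := by
    rw [Complex.exp_mul_I]
    ext i j
    by_cases hij : i = j <;>
      simp [rotation, J, toBlocks₁₁, toBlocks₂₁, hij, mul_comm Complex.I]
  rw [complexDet, h, det_smul, det_one, mul_one, Fintype.card_fin, Complex.exp_nat_mul]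

/-- The path `t ↦ e^{iθt}`. -/
noncomputable def rotationPath (n : ℕ) (θ : ℝ) : basedPaths n :=
  ⟨⟨fun t => rotation n (θ * t), continuous_rotation.comp (by fun_prop)⟩, by
    change rotation n (θ * ((0 : unitInterval) : ℝ)) = 1
    simp [rotation_zero]⟩

theorem proj_rotationPath (θ : ℝ) : proj n (rotationPath n θ : SpCover n) = rotation n θ := by
  change rotation n (θ * ((1 : unitInterval) : ℝ)) = _
  simp

/-- Conjugation by a path only depends on its end-point, up to homotopy. -/
theorem mk_conj_eq {j p r : basedPaths n} (h : ∀ t, (j : C(unitInterval, Sp n)) 1 *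
      (p : C(unitInterval, Sp n)) t * ((j : C(unitInterval, Sp n)) 1)⁻¹ =
      (r : C(unitInterval, Sp n)) t) :
    (j : SpCover n) * p * (j : SpCover n)⁻¹ = r := by
  have h' : ((j * p * j⁻¹ : basedPaths n) : SpCover n) = r := by
    rw [mk_eq_mk_iff]
    let a : C(unitInterval, Sp n) := j
    let b : C(unitInterval, Sp n) := p
    -- Replacing the conjugator's time `t` by `max s t` deforms pointwise conjugation into
    -- conjugation by the end-point, with both ends fixed.
    have hc : Continuous fun x : unitInterval × unitInterval =>
        a (max x.1 x.2) * b x.2 * (a (max x.1 x.2))⁻¹ := by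
      have : Continuous fun x : unitInterval × unitInterval => a (max x.1 x.2) :=
        a.continuous.comp (continuous_fst.max continuous_snd)
      exact (this.mul (b.continuous.comp continuous_snd)).mul this.inv
    refine ⟨⟨⟨⟨_, hc⟩, fun t => ?_, fun t => ?_⟩, fun s t ht => ?_⟩⟩
    · change a (max 0 t) * b t * (a (max 0 t))⁻¹ = a t * b t * (a t)⁻¹
      rw [max_eq_right (show (0 : unitInterval) ≤ t from t.2.1)]
    · change a (max 1 t) * b t * (a (max 1 t))⁻¹ = _
      rw [max_eq_left (show t ≤ 1 from t.2.2)]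
      exact h t
    · change a (max s t) * b t * (a (max s t))⁻¹ = a t * b t * (a t)⁻¹
      rcases ht with rfl | rfl
      · have : b 0 = 1 := p.2
        simp [this]
      · rw [max_eq_right (show s ≤ 1 from s.2.2)]
  exact h'

end Rotation

/-! ### Uniqueness of the Maslov quasimorphism. -/

section Maslov

variable {n : ℕ}

/-- The shortened paths `t ↦ u(st)` join `1` to `u` over `U(n)`; along them both functions lift the
same determinant. -/
theorem IsMaslov.eq_on_unitary_path {μ ν : SpCover n → ℝ} (hμ : IsMaslov μ) (hν : IsMaslov ν)
    {u : basedPaths n} (hu : ∀ t, (u : C(unitInterval, Sp n)) t ∈ unitarySet n) :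
    μ u = ν u := by
  let a : C(unitInterval, Sp n) := u
  let H : C(unitInterval × unitInterval, Sp n) :=
    ⟨fun x => a (x.1 * x.2), a.continuous.comp (by fun_prop)⟩
  have hmem : ∀ s, H.curry s ∈ basedPaths n := fun s => by
    change a (s * 0) = 1
    rw [mul_zero]
    exact u.2
  let Γ : unitInterval → SpCover n := fun s => ((⟨H.curry s, hmem s⟩ : basedPaths n) : SpCover n)
  have hΓ : Continuous Γ :=
    QuotientGroup.continuous_mk.comp (H.curry.continuous.subtype_mk hmem)
  have hΓU : ∀ s, Γ s ∈ proj n ⁻¹' unitarySet n := fun s => hu (s * 1)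
  have hΓ0 : Γ 0 = 1 := by
    have : (⟨H.curry 0, hmem 0⟩ : basedPaths n) = 1 := by
      refine Subtype.ext (ContinuousMap.ext fun t => ?_)
      change a (0 * t) = 1
      rw [zero_mul]
      exact u.2
    change ((⟨H.curry 0, hmem 0⟩ : basedPaths n) : SpCover n) = 1
    rw [this]
    rfl
  have hΓ1 : Γ 1 = u := by
    refine congrArg _ (Subtype.ext (ContinuousMap.ext fun t => ?_))
    change a (1 * t) = a t
    rw [one_mul]
  have key : ∀ {ρ : SpCover n → ℝ}, IsMaslov ρ →
      Continuous fun s => 2 * Real.pi * Complex.I * (ρ (Γ s) : ℂ) := by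
    intro ρ hρ
    have h1 : Continuous fun s => ρ (Γ s) := hρ.2.2.1.comp_continuous hΓ hΓU
    exact continuous_const.mul (Complex.continuous_ofReal.comp h1)
  have hone : ∀ {ρ : SpCover n → ℝ}, IsMaslov ρ → ρ 1 = 0 := fun hρ => by
    simpa using hρ.2.1 1 0
  have h := log_lift_unique (key hμ) (key hν)
    (fun s => (hμ.2.2.2 _ (hΓU s)).trans (hν.2.2.2 _ (hΓU s)).symm)
    (x₀ := 0) (by rw [hΓ0, hone hμ, hone hν]) 1
  have h2 := mul_left_cancel₀ (by simp [Real.pi_ne_zero]) h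
  rw [hΓ1] at h2
  exact_mod_cast h2

theorem IsMaslov.unique {μ ν : SpCover n → ℝ} (hμ : IsMaslov μ) (hν : IsMaslov ν) : ν = μ := by
  have hq := hν.1.sub hμ.1
  have hh := hν.2.1.sub hμ.2.1
  -- Lifting `J₀` to the quarter turn path makes `p` conjugate to `p⁻¹` in the cover, so the
  -- difference equals its own negative there.
  have hp : ∀ p : basedPaths n, (∀ t, SymplecticGroup.symJ (Fin n) ℝ *
      (p : C(unitInterval, Sp n)) t * (SymplecticGroup.symJ (Fin n) ℝ)⁻¹ =
      ((p : C(unitInterval, Sp n)) t)⁻¹) → ν p - μ p = 0 := by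
    intro p hp
    have h1 : (rotationPath n (Real.pi / 2) : SpCover n) * p *
        (rotationPath n (Real.pi / 2) : SpCover n)⁻¹ = ((p⁻¹ : basedPaths n) : SpCover n) := by
      refine mk_conj_eq fun t => ?_
      have h2 : (rotationPath n (Real.pi / 2) : C(unitInterval, Sp n)) 1 =
          SymplecticGroup.symJ (Fin n) ℝ :=
        (proj_rotationPath (Real.pi / 2)).trans rotation_pi_div_two
      rw [h2]
      exact hp t
    have h3 := hq.map_conj hh (rotationPath n (Real.pi / 2) : SpCover n) p
    rw [h1] at h3
    have h4 := hh.map_inv (p : SpCover n)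
    have h5 : ((p⁻¹ : basedPaths n) : SpCover n) = (p : SpCover n)⁻¹ := rfl
    rw [h5] at h3
    linarith
  obtain ⟨C, hC⟩ := hq
  have hbound : ∀ w, |ν w - μ w| ≤ C := by
    intro w
    induction w using QuotientGroup.induction_on with
    | H γ =>
      obtain ⟨u, p, rfl, hu, hpJ⟩ := exists_polar γ
      have h1 : |ν (u * p : SpCover n) - μ (u * p : SpCover n) - (ν u - μ u) - (ν p - μ p)| ≤ C :=
        hC u p
      rw [hp p hpJ, hμ.eq_on_unitary_path hν hu, sub_self, sub_zero, sub_zero] at h1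
      exact h1
  funext w
  have := hh.eq_zero_of_abs_le hbound w
  linarith

end Maslov

end SympTime

/-! ### Existence of `μ` and its approximation by time functions. -/

theorem mainTheorem3 (n : ℕ) (hn : 1 ≤ n) :
    ∃ μ : SympTime.SpCover n → ℝ,
      SympTime.IsMaslov μ ∧
      (∀ ν : SympTime.SpCover n → ℝ, SympTime.IsMaslov ν → ν = μ) ∧
      ∀ ε : ℝ, 0 < ε →
        ∃ f : SympTime.SpCover n → ℝ,
          SympTime.IsTimeFunction f ∧
          SympTime.IsQuasimorphism f ∧
          (∀ C : ℝ, ∃ w, C < |f w|) ∧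
          ∀ w, |f w - μ w| ≤ ε := by
  obtain ⟨μ, hμh, hμb⟩ := SympTime.exists_homogenization
    (SympTime.abs_angle_mul_sub_le (n := n))
  have hμq : SympTime.IsQuasimorphism μ :=
    SympTime.IsQuasimorphism.of_abs_sub_le ⟨_, SympTime.abs_angle_mul_sub_le⟩ hμb
  have hμU : ∀ w, SympTime.proj n w ∈ SympTime.unitarySet n → μ w = SympTime.angle w := by
    intro w hw
    have h : SympTime.angle w - μ w = 0 := by
      refine SympTime.eq_zero_of_forall_nat_mul_le (C := n / 2) fun k => ?_
      have := hμb (w ^ k)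
      rwa [SympTime.angle_pow_of_mem hw, hμh.map_pow, ← mul_sub, abs_mul, Nat.abs_cast] at this
    linarith
  have hμ : SympTime.IsMaslov μ := by
    refine ⟨hμq, hμh, SympTime.continuous_angle.continuousOn.congr fun w hw => hμU w hw,
      fun w hw => ?_⟩
    rw [hμU w hw]
    exact SympTime.exp_angle_of_mem hw
  refine ⟨μ, hμ, fun ν hν => hμ.unique hν, fun ε hε => ?_⟩
  -- The error `n/2` is divided by `k + 1`, which must bring it below `ε`.
  obtain ⟨k, hk⟩ := exists_nat_gt ((n / 2 : ℝ) / ε)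
  have hclose : ∀ w, |SympTime.angle (w ^ (k + 1)) / (k + 1) - μ w| ≤ ε := by
    intro w
    have h1 := hμb (w ^ (k + 1))
    rw [hμh.map_pow] at h1
    have hk1 : (0 : ℝ) < k + 1 := by positivity
    have h2 : SympTime.angle (w ^ (k + 1)) / (k + 1) - μ w =
        (SympTime.angle (w ^ (k + 1)) - ((k + 1 : ℕ) : ℝ) * μ w) / (k + 1) := by
      push_cast
      field_simp
    rw [h2, abs_div, abs_of_pos hk1, div_le_iff₀ hk1]
    have h3 := (div_lt_iff₀ hε).1 hk
    nlinarith
  refine ⟨_, SympTime.isTimeFunction_angle_pow n k,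
    hμq.of_abs_sub_le fun w => by rw [abs_sub_comm]; exact hclose w, fun C => ?_, hclose⟩
  have hne : ∃ w, μ w ≠ 0 := by
    -- The scalar `e^{iπ/n}` has determinant `-1 ≠ 1`, so `μ` cannot vanish on its lift; here `n ≥
    -- 1` is needed.
    refine ⟨(SympTime.rotationPath n (Real.pi / n) : SympTime.SpCover n), fun h0 => ?_⟩
    have h1 := hμ.2.2.2 (SympTime.rotationPath n (Real.pi / n) : SympTime.SpCover n)
      (by rw [SympTime.proj_rotationPath]; exact SympTime.rotation_mem_unitarySet _)
    have hn0 : (n : ℂ) ≠ 0 := by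
      have : n ≠ 0 := by omega
      exact_mod_cast this
    rw [h0, SympTime.proj_rotationPath, SympTime.complexDet_rotation] at h1
    push_cast at h1
    rw [show (n : ℂ) * (Real.pi / n * Complex.I) = Real.pi * Complex.I by field_simp,
      Complex.exp_pi_mul_I] at h1
    norm_num at h1
  by_contra hcon
  push Not at hcon
  obtain ⟨w, hw⟩ := hne
  -- A bound on `f` would bound `μ`, and a bounded homogeneous function is zero.
  refine hw (hμh.eq_zero_of_abs_le (C := C + ε) (fun v => ?_) w)
  have h1 := hcon v
  have h2 := hclose v
  rw [abs_le] at h1 h2 ⊢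
  constructor <;> linarith [h1.1, h1.2, h2.1, h2.2]
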